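/- Let $\lambda\in\mathbb{C}$. Let $Q$ be the quiver with two vertices $R$ and $M$, two loops $a,b$ at $M$, one arrow $c\colon M\to R$ and one arrow $d\colon R\to M$. Paths are composed from right to left, so that $dc$ means "first $c$, then $d$". Let $A$ be the quotient of the path algebra $\mathbb{C}Q$ by the two-sided ideal generated by the relations $$(b^2+dc)d=0,\qquad c(b^2+dc)=0,\qquad ab+ba=0,\qquad a^2+bdc+dcb+\lambda b^2+b^3=0 .$$ For a vertex $v$ let $e_v\in A$ be the class of the trivial path at $v$, let $P_v=e_vA$ (the right $A$-module spanned by the classes of the paths ending at $v$), and let $L_v$ be the one-dimensional right $A$-module on which $e_v$ acts as the identity and the other trivial path and all arrows act as zero. Left multiplication by an element of $e_jAe_i$ is a homomorphism $P_i\to P_j$ of right $A$-modules. Consider the sequence of right $A$-modules $$0\to P_M\xrightarrow{\;f_2\;}P_R\oplus P_M^{\oplus2}\xrightarrow{\;f_1\;}P_R\oplus P_M^{\oplus2}\xrightarrow{\;f_0\;}P_M\xrightarrow{\;\varepsilon\;}L_M\to0,$$ where $$f_2=\begin{pmatrix}c\\a\\b\end{pmatrix},\qquad f_1=\begin{pmatrix}cd&0&cb\\0&b&a\\bd&a&dc+\lambda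 b+b^2\end{pmatrix},\qquad f_0=\begin{pmatrix}d&a&b\end{pmatrix},$$ and $\varepsilon$ is the canonical surjection, sending $e_M$ to $1$ and every path of positive length ending at $M$ to $0$. Then this sequence is a complex and is exact at every term, and $P_R$ and $P_M$ are projective, so that it is a projective resolution of the vertex simple $L_M$. Moreover, left multiplication by $b$ is injective on $P_M$. -/

import Mathlib

/-! ## The path algebra of a finite quiver -/

/-- A path of the quiver `V`, together with its source and its target. -/
structure QuiverPath (V : Type) [Quiver.{0} V] where
  /-- the vertex where the path begins -/
  src : V
  /-- the vertex where the path ends -/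
  tgt : V
  /-- the path itself -/
  path : Quiver.Path src tgt

/-- The path algebra: the `k`-vector space with basis the set of all paths of `V`. -/
def PathAlgebra (k V : Type) [Field k] [Quiver.{0} V] : Type := QuiverPath V →₀ k

noncomputable section

namespace PathAlgebra

variable {k V : Type} [Field k] [Quiver.{0} V]

instance : AddCommGroup (PathAlgebra k V) := inferInstanceAs (AddCommGroup (QuiverPath V →₀ k))

instance : Module k (PathAlgebra k V) := inferInstanceAs (Module k (QuiverPath V →₀ k))

variable (k) in
/-- The basis element of the path algebra given by a path. -/
def ofPath (p : QuiverPath V) : PathAlgebra k V := Finsupp.single p (1 : k)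

variable (k) in
/-- The trivial path at the vertex `v`. -/
def idem (v : V) : PathAlgebra k V := ofPath k ⟨v, v, Quiver.Path.nil⟩

variable (k) in
/-- The path of length one given by an arrow. -/
def ofArrow {i j : V} (f : i ⟶ j) : PathAlgebra k V := ofPath k ⟨i, j, f.toPath⟩

open Classical in
variable (k) in
/-- The product of two paths, composed from right to left: `p * q` is "first `q`, then `p`" if `q`
ends where `p` begins, and `0` otherwise. -/
def mulPath (p q : QuiverPath V) : PathAlgebra k V :=
  if h : q.tgt = p.src then ofPath k ⟨q.src, p.tgt, q.path.comp (p.path.cast h.symm rfl)⟩ else 0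

variable (k V) in
/-- The bilinear extension of the product of paths. -/
def mulBilin : PathAlgebra k V →ₗ[k] PathAlgebra k V →ₗ[k] PathAlgebra k V :=
  Finsupp.lift (PathAlgebra k V →ₗ[k] PathAlgebra k V) k (QuiverPath V) fun p =>
    Finsupp.lift (PathAlgebra k V) k (QuiverPath V) fun q => mulPath k p q

instance : Mul (PathAlgebra k V) := ⟨fun x y => mulBilin k V x y⟩

/-- The unit is the sum of all trivial paths. -/
instance [Fintype V] : One (PathAlgebra k V) := ⟨∑ v : V, idem k v⟩

theorem mul_def (x y : PathAlgebra k V) : x * y = mulBilin k V x y := rfl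

theorem one_def [Fintype V] : (1 : PathAlgebra k V) = ∑ v : V, idem k v := rfl

theorem ofPath_mul_ofPath (p q : QuiverPath V) : ofPath k p * ofPath k q = mulPath k p q := by
  rw [mul_def]
  have h : mulBilin k V (ofPath k p)
      = Finsupp.lift (PathAlgebra k V) k (QuiverPath V) fun q => mulPath k p q := by
    refine (Finsupp.lift_apply _ _ _ _ _).trans ?_
    refine (Finsupp.sum_single_index ?_).trans (one_smul k _)
    exact zero_smul k _
  rw [h]
  refine (Finsupp.lift_apply _ _ _ _ _).trans ?_
  refine (Finsupp.sum_single_index ?_).trans (one_smul k _)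
  exact zero_smul k _

theorem ofPath_mul_ofPath_comp {i j l : V} (p : Quiver.Path j l) (q : Quiver.Path i j) :
    ofPath k ⟨j, l, p⟩ * ofPath k ⟨i, j, q⟩ = ofPath k ⟨i, l, q.comp p⟩ := by
  rw [ofPath_mul_ofPath, mulPath, dif_pos rfl]
  rfl

theorem ofPath_mul_ofPath_ne {p q : QuiverPath V} (h : q.tgt ≠ p.src) :
    ofPath k p * ofPath k q = 0 := by
  rw [ofPath_mul_ofPath, mulPath, dif_neg h]

/-- Induction principle: the paths span the path algebra. -/
theorem induction_paths {motive : PathAlgebra k V → Prop} (x : PathAlgebra k V)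
    (zero : motive 0) (add : ∀ x y, motive x → motive y → motive (x + y))
    (smul_path : ∀ (r : k) (p : QuiverPath V), motive (r • ofPath k p)) : motive x := by
  refine Finsupp.induction_linear (motive := motive) x zero add fun p r => ?_
  have h : (Finsupp.single p r : QuiverPath V →₀ k) = r • Finsupp.single p (1 : k) := by simp
  rw [h]
  exact smul_path r p

theorem add_mul' (x y z : PathAlgebra k V) : (x + y) * z = x * z + y * z := by
  simp [mul_def]

theorem mul_add' (x y z : PathAlgebra k V) : x * (y + z) = x * y + x * z := by
  simp [mul_def]

theorem smul_mul' (r : k) (x y : PathAlgebra k V) : r • x * y = r • (x * y) := by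
  simp [mul_def]

theorem mul_smul' (r : k) (x y : PathAlgebra k V) : x * r • y = r • (x * y) := by
  simp [mul_def]

theorem zero_mul' (x : PathAlgebra k V) : 0 * x = 0 := by
  simp [mul_def]

theorem mul_zero' (x : PathAlgebra k V) : x * 0 = 0 := by
  simp [mul_def]

theorem ofPath_mul_assoc (p q r : QuiverPath V) :
    ofPath k p * ofPath k q * ofPath k r = ofPath k p * (ofPath k q * ofPath k r) := by
  obtain ⟨p₁, p₂, p⟩ := p
  obtain ⟨q₁, q₂, q⟩ := q
  obtain ⟨r₁, r₂, r⟩ := r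
  by_cases h : q₂ = p₁
  · subst h
    by_cases h' : r₂ = q₁
    · subst h'
      simp only [ofPath_mul_ofPath_comp, Quiver.Path.comp_assoc]
    · rw [ofPath_mul_ofPath_comp, ofPath_mul_ofPath_ne (p := ⟨q₁, _, _⟩) h',
        ofPath_mul_ofPath_ne (p := ⟨q₁, _, _⟩) h', mul_zero']
  · rw [ofPath_mul_ofPath_ne h, zero_mul']
    by_cases h' : r₂ = q₁
    · subst h'
      rw [ofPath_mul_ofPath_comp, ofPath_mul_ofPath_ne h]
    · rw [ofPath_mul_ofPath_ne (p := ⟨q₁, _, _⟩) h', mul_zero']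

theorem mul_assoc' (x y z : PathAlgebra k V) : x * y * z = x * (y * z) := by
  induction x using induction_paths with
  | zero => simp only [zero_mul']
  | add x x' hx hx' => simp only [add_mul', hx, hx']
  | smul_path r p =>
    induction y using induction_paths with
    | zero => simp only [zero_mul', mul_zero']
    | add y y' hy hy' => simp only [add_mul', mul_add', hy, hy']
    | smul_path s q =>
      induction z using induction_paths with
      | zero => simp only [mul_zero']
      | add z z' hz hz' => simp only [mul_add', hz, hz']
      | smul_path t u => simp only [smul_mul', mul_smul', ofPath_mul_assoc]

theorem finset_sum_mul' {ι : Type} (s : Finset ι) (f : ι → PathAlgebra k V)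
    (x : PathAlgebra k V) : (∑ i ∈ s, f i) * x = ∑ i ∈ s, f i * x := by
  simp [mul_def]

theorem mul_finset_sum' {ι : Type} (s : Finset ι) (f : ι → PathAlgebra k V)
    (x : PathAlgebra k V) : x * (∑ i ∈ s, f i) = ∑ i ∈ s, x * f i := by
  simp [mul_def]

theorem one_mul' [Fintype V] (x : PathAlgebra k V) : 1 * x = x := by
  induction x using induction_paths with
  | zero => simp only [mul_zero']
  | add x y hx hy => simp only [mul_add', hx, hy]
  | smul_path r p =>
    obtain ⟨i, j, p⟩ := p
    rw [mul_smul', one_def, finset_sum_mul', Finset.sum_eq_single j]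
    · rw [idem, ofPath_mul_ofPath_comp, Quiver.Path.comp_nil]
    · intro v _ hv
      exact ofPath_mul_ofPath_ne (Ne.symm hv)
    · intro h
      exact absurd (Finset.mem_univ j) h

theorem mul_one' [Fintype V] (x : PathAlgebra k V) : x * 1 = x := by
  induction x using induction_paths with
  | zero => simp only [zero_mul']
  | add x y hx hy => simp only [add_mul', hx, hy]
  | smul_path r p =>
    obtain ⟨i, j, p⟩ := p
    rw [smul_mul', one_def, mul_finset_sum', Finset.sum_eq_single i]
    · rw [idem, ofPath_mul_ofPath_comp, Quiver.Path.nil_comp]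
    · intro v _ hv
      exact ofPath_mul_ofPath_ne hv
    · intro h
      exact absurd (Finset.mem_univ i) h

instance [Fintype V] : Ring (PathAlgebra k V) :=
  { (inferInstance : AddCommGroup (PathAlgebra k V)) with
    mul := (· * ·)
    one := 1
    left_distrib := mul_add'
    right_distrib := add_mul'
    zero_mul := zero_mul'
    mul_zero := mul_zero'
    mul_assoc := mul_assoc'
    one_mul := one_mul'
    mul_one := mul_one' }

instance [Fintype V] : Algebra k (PathAlgebra k V) := Algebra.ofModule smul_mul' fun r x y =>
  mul_smul' r x y

/-- The coefficient of the trivial path at `v`, as a linear functional. -/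
def coeffIdem (v : V) : PathAlgebra k V →ₗ[k] k := Finsupp.lapply ⟨v, v, Quiver.Path.nil⟩

theorem coeffIdem_idem (v : V) : coeffIdem v (idem k v) = 1 := Finsupp.single_eq_same

theorem coeffIdem_ofPath_of_ne {v : V} {p : QuiverPath V} (h : p ≠ ⟨v, v, Quiver.Path.nil⟩) :
    coeffIdem v (ofPath k p) = 0 := Finsupp.single_eq_of_ne h.symm

theorem coeffIdem_ofArrow (v : V) {i j : V} (f : i ⟶ j) : coeffIdem v (ofArrow k f) = 0 := by
  refine coeffIdem_ofPath_of_ne fun h => ?_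
  rw [QuiverPath.mk.injEq] at h
  obtain ⟨rfl, rfl, h⟩ := h
  exact Quiver.Path.cons_ne_nil _ _ (eq_of_heq h)

theorem coeffIdem_mul (v : V) (x y : PathAlgebra k V) :
    coeffIdem v (x * y) = coeffIdem v x * coeffIdem v y := by
  induction x using induction_paths with
  | zero => simp only [zero_mul', map_zero, zero_mul]
  | add x x' hx hx' => simp only [add_mul', map_add, hx, hx', add_mul]
  | smul_path r p =>
    induction y using induction_paths with
    | zero => simp only [mul_zero', map_zero, mul_zero]
    | add y y' hy hy' => simp only [mul_add', map_add, hy, hy', mul_add]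
    | smul_path s q =>
      suffices h : coeffIdem v (ofPath k p * ofPath k q)
          = coeffIdem v (ofPath k p) * coeffIdem v (ofPath k q) by
        simp only [smul_mul', mul_smul', map_smul, h, smul_eq_mul]
        ring
      obtain ⟨p₁, p₂, p⟩ := p
      obtain ⟨q₁, q₂, q⟩ := q
      by_cases hpq : q₂ = p₁
      · subst hpq
        rw [ofPath_mul_ofPath_comp]
        cases p with
        | nil =>
          rw [Quiver.Path.comp_nil]
          by_cases hv : p₂ = v
          · subst hv
            change _ = coeffIdem p₂ (idem k p₂) * _
            rw [coeffIdem_idem, one_mul]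
          · rw [coeffIdem_ofPath_of_ne, coeffIdem_ofPath_of_ne, zero_mul]
            · intro h
              rw [QuiverPath.mk.injEq] at h
              exact hv h.1
            · intro h
              rw [QuiverPath.mk.injEq] at h
              exact hv h.2.1
        | cons p e =>
          rw [coeffIdem_ofPath_of_ne, coeffIdem_ofPath_of_ne, zero_mul]
          · intro h
            rw [QuiverPath.mk.injEq] at h
            obtain ⟨rfl, rfl, h⟩ := h
            exact Quiver.Path.cons_ne_nil _ _ (eq_of_heq h)
          · intro h
            rw [QuiverPath.mk.injEq] at h
            obtain ⟨rfl, rfl, h⟩ := h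
            exact Quiver.Path.cons_ne_nil _ _ (eq_of_heq h)
      · rw [ofPath_mul_ofPath_ne hpq, map_zero]
        by_cases hv : q₂ = v
        · rw [coeffIdem_ofPath_of_ne (p := ⟨p₁, _, _⟩), zero_mul]
          intro h
          rw [QuiverPath.mk.injEq] at h
          exact hpq (hv.trans h.1.symm)
        · rw [coeffIdem_ofPath_of_ne (p := ⟨q₁, _, _⟩), mul_zero]
          intro h
          rw [QuiverPath.mk.injEq] at h
          exact hv h.2.1

theorem coeffIdem_one [Fintype V] (v : V) : coeffIdem v (1 : PathAlgebra k V) = 1 := by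
  rw [one_def, map_sum, Finset.sum_eq_single v]
  · exact coeffIdem_idem v
  · intro w _ hw
    refine coeffIdem_ofPath_of_ne fun h => ?_
    rw [QuiverPath.mk.injEq] at h
    exact hw h.1
  · intro h
    exact absurd (Finset.mem_univ v) h

/-- The one-dimensional character of the path algebra at the vertex `v`: it sends the trivial path
at `v` to `1` and every other path to `0`. -/
def character [Fintype V] (v : V) : PathAlgebra k V →ₐ[k] k :=
  AlgHom.ofLinearMap (coeffIdem v) (coeffIdem_one v) (coeffIdem_mul v)

end PathAlgebra

/-! ## The Morrison–Pinkham quiver with its relations -/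

namespace MorrisonPinkham

/-- The two vertices of the quiver. -/
inductive Vertex : Type
  | R : Vertex
  | M : Vertex
  deriving DecidableEq

instance : Fintype Vertex where
  elems := {Vertex.R, Vertex.M}
  complete v := by cases v <;> simp

/-- The arrows: two loops `a`, `b` at `M`, one arrow `c` from `M` to `R` and one arrow `d` from `R`
to `M`. -/
inductive Arrow : Vertex → Vertex → Type
  | a : Arrow Vertex.M Vertex.M
  | b : Arrow Vertex.M Vertex.M
  | c : Arrow Vertex.M Vertex.R
  | d : Arrow Vertex.R Vertex.M

instance : Quiver Vertex := ⟨Arrow⟩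

/-- The complex path algebra of the quiver, before relations are imposed. -/
abbrev FreePaths : Type := PathAlgebra ℂ Vertex

/-- An arrow of the quiver as an element of the path algebra. -/
def arrow {i j : Vertex} (f : Arrow i j) : FreePaths := PathAlgebra.ofArrow ℂ (V := Vertex) f

/-- The relations, products of paths being read from right to left. -/
inductive Rel (lam : ℂ) : FreePaths → FreePaths → Prop
  | rel_c : Rel lam ((arrow .b ^ 2 + arrow .d * arrow .c) * arrow .d) 0
  | rel_d : Rel lam (arrow .c * (arrow .b ^ 2 + arrow .d * arrow .c)) 0
  | rel_a : Rel lam (arrow .a * arrow .b + arrow .b * arrow .a) 0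
  | rel_b : Rel lam (arrow .a ^ 2 + arrow .b * arrow .d * arrow .c
      + arrow .d * arrow .c * arrow .b + lam • arrow .b ^ 2 + arrow .b ^ 3) 0

/-- The Morrison–Pinkham algebra: the path algebra modulo the two-sided ideal generated by the
relations. -/
abbrev Alg (lam : ℂ) : Type := RingQuot (Rel lam)

section Elements

variable (lam : ℂ)

/-- The class of the trivial path at the vertex `v`. -/
def e (v : Vertex) : Alg lam := RingQuot.mkAlgHom ℂ (Rel lam) (PathAlgebra.idem ℂ v)

/-- The class of the arrow `a : M → M`. -/
def a : Alg lam := RingQuot.mkAlgHom ℂ (Rel lam) (arrow .a)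

/-- The class of the arrow `b : M → M`. -/
def b : Alg lam := RingQuot.mkAlgHom ℂ (Rel lam) (arrow .b)

/-- The class of the arrow `c : M → R`. -/
def c : Alg lam := RingQuot.mkAlgHom ℂ (Rel lam) (arrow .c)

/-- The class of the arrow `d : R → M`. -/
def d : Alg lam := RingQuot.mkAlgHom ℂ (Rel lam) (arrow .d)

theorem e_mul_arrow {i j : Vertex} (f : Arrow i j) :
    e lam j * RingQuot.mkAlgHom ℂ (Rel lam) (arrow f)
      = RingQuot.mkAlgHom ℂ (Rel lam) (arrow f) := by
  rw [e, ← map_mul]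
  exact congrArg _ (PathAlgebra.ofPath_mul_ofPath_comp _ _)

theorem e_mul_a : e lam .M * a lam = a lam := e_mul_arrow lam .a

theorem e_mul_b : e lam .M * b lam = b lam := e_mul_arrow lam .b

theorem e_mul_c : e lam .R * c lam = c lam := e_mul_arrow lam .c

theorem e_mul_d : e lam .M * d lam = d lam := e_mul_arrow lam .d

end Elements

/-! ## Projective right modules and the vertex simples

Right modules over `Alg lam` are modules over `(Alg lam)ᵐᵒᵖ`. -/

section Modules

variable (lam : ℂ)

/-- Left multiplication by `x`, as an endomorphism of the right regular module. -/
def leftMul (x : Alg lam) : Alg lam →ₗ[(Alg lam)ᵐᵒᵖ] Alg lam where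
  toFun y := x * y
  map_add' y z := mul_add x y z
  map_smul' r y := (mul_assoc x y r.unop).symm

/-- The right ideal `e_v A`, spanned by the paths that end at `v`. -/
def P (v : Vertex) : Submodule (Alg lam)ᵐᵒᵖ (Alg lam) := LinearMap.range (leftMul lam (e lam v))

variable {lam} in
theorem mul_mem_P {v : Vertex} {x : Alg lam} (hx : e lam v * x = x) (y : Alg lam) :
    x * y ∈ P lam v :=
  ⟨x * y, by change e lam v * (x * y) = x * y; rw [← mul_assoc, hx]⟩

/-- Left multiplication by an element `x` of `e_j A` as a homomorphism of right modules
`e_i A → e_j A`. -/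
def mulMap (i j : Vertex) (x : Alg lam) (hx : e lam j * x = x) :
    P lam i →ₗ[(Alg lam)ᵐᵒᵖ] P lam j :=
  (leftMul lam x).restrict fun y _ => mul_mem_P hx y

/-- The character of the Morrison–Pinkham algebra at the vertex `v`: it sends the trivial path at
`v` to `1`, and the other trivial path and all arrows to `0`. -/
def character (v : Vertex) : Alg lam →ₐ[ℂ] ℂ :=
  RingQuot.liftAlgHom ℂ ⟨PathAlgebra.character v, by
    have h : ∀ {i j : Vertex} (f : Arrow i j),
        PathAlgebra.character (k := ℂ) v (arrow f) = 0 := fun f =>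
      PathAlgebra.coeffIdem_ofArrow (V := Vertex) v f
    intro x y hxy
    cases hxy <;> simp [h]⟩

/-- The vertex simple `L_v`: the one-dimensional representation at the vertex `v`. -/
def VertexSimple (_ : ℂ) (_ : Vertex) : Type := ℂ

instance (v : Vertex) : AddCommGroup (VertexSimple lam v) := inferInstanceAs (AddCommGroup ℂ)

/-- An element `x` of the algebra acts on `L_v` from the right through the character at `v`. -/
instance (v : Vertex) : Module (Alg lam)ᵐᵒᵖ (VertexSimple lam v) where
  smul r z := (show ℂ from z) * character lam v r.unop
  one_smul z := by
    change (show ℂ from z) * character lam v 1 = z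
    rw [map_one, mul_one]
  mul_smul r s z := by
    change (show ℂ from z) * character lam v (s.unop * r.unop)
      = (show ℂ from z) * character lam v s.unop * character lam v r.unop
    rw [map_mul, mul_assoc]
  smul_zero r := zero_mul (character lam v r.unop)
  smul_add r y z := add_mul (show ℂ from y) (show ℂ from z) (character lam v r.unop)
  add_smul r s z := by
    change (show ℂ from z) * character lam v (r.unop + s.unop)
      = (show ℂ from z) * character lam v r.unop + (show ℂ from z) * character lam v s.unop
    rw [map_add, mul_add]
  zero_smul z := by
    change (show ℂ from z) * character lam v 0 = 0
    rw [map_zero, mul_zero]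

/-- The canonical surjection `e_v A → L_v`: the class of the trivial path goes to `1`, the classes
of all longer paths go to `0`. -/
def augmentation (v : Vertex) : P lam v →ₗ[(Alg lam)ᵐᵒᵖ] VertexSimple lam v where
  toFun y := character lam v (y : Alg lam)
  map_add' y z := map_add (character lam v) (y : Alg lam) (z : Alg lam)
  map_smul' r y := map_mul (character lam v) (y : Alg lam) r.unop

end Modules

/-! ## The complex -/

section Complex

variable (lam : ℂ)

/-- The matrix `(c, a, b)ᵀ`. -/
def f₂ : P lam .M →ₗ[(Alg lam)ᵐᵒᵖ] P lam .R × P lam .M × P lam .M :=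
  (mulMap lam .M .R (c lam) (e_mul_c lam)).prod
    ((mulMap lam .M .M (a lam) (e_mul_a lam)).prod (mulMap lam .M .M (b lam) (e_mul_b lam)))

/-- The matrix with rows `(c d, 0, c b)`, `(0, b, a)` and `(b d, a, d c + λ b + b²)`. -/
def f₁ : P lam .R × P lam .M × P lam .M →ₗ[(Alg lam)ᵐᵒᵖ] P lam .R × P lam .M × P lam .M :=
  LinearMap.prod
    (LinearMap.coprod
      (mulMap lam .R .R (c lam * d lam) (by rw [← mul_assoc, e_mul_c]))
      (LinearMap.coprod
        0
        (mulMap lam .M .R (c lam * b lam) (by rw [← mul_assoc, e_mul_c]))))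
    (LinearMap.prod
      (LinearMap.coprod
        0
        (LinearMap.coprod
          (mulMap lam .M .M (b lam) (e_mul_b lam))
          (mulMap lam .M .M (a lam) (e_mul_a lam))))
      (LinearMap.coprod
        (mulMap lam .R .M (b lam * d lam) (by rw [← mul_assoc, e_mul_b]))
        (LinearMap.coprod
          (mulMap lam .M .M (a lam) (e_mul_a lam))
          (mulMap lam .M .M (d lam * c lam + lam • b lam + b lam ^ 2) (by
            rw [mul_add, mul_add, mul_smul_comm, pow_two, ← mul_assoc, ← mul_assoc, e_mul_d,
              e_mul_b])))))

/-- The matrix `(d, a, b)`. -/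
def f₀ : P lam .R × P lam .M × P lam .M →ₗ[(Alg lam)ᵐᵒᵖ] P lam .M :=
  (mulMap lam .R .M (d lam) (e_mul_d lam)).coprod
    ((mulMap lam .M .M (a lam) (e_mul_a lam)).coprod (mulMap lam .M .M (b lam) (e_mul_b lam)))

end Complex

end MorrisonPinkham

end

/-! The algebra `A` is finite over a polynomial ring in three central elements: z = b² − cd, w =
(dcb + bdc + b³) + cbd and y = (dca + adc + b²a) + cad, each split into its components in e_M A e_M
and e_R A e_R. On e_M A one has b² = z, and the last relation says a² = −w − λz; on e_R A one has cd
= −z, cbd = w and cad = y. Over ℂ[z, w, y] the module e_M A is spanned by the products of e_M, b, a,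
ba with e_M, dc, d, and e_R A by c, ca, cb, cba, e_R, cbad.

Left multiplication by the arrows on these spanning sets gives polynomial matrices on a free module,
`Model`. The matrices satisfy the relations (`freeAction_rel`), so `A` acts on `Model`. Mapping
coordinates to the elements they describe is left `A`-linear (`realize_action`) and hits 1, so x ↦ x
· `modelOne` is an `A`-linear injection with left inverse `realize` (`realize_coords`). Questions
about left multiplication in `A` thereby become questions about matrices over ℂ[z, w, y].

Four facts suffice: b is injective on e_M A; d is injective on e_R A; for x in e_M A, ax ∈ bA forces
x ∈ bA; for x in e_R A, dx ∈ aA + bA forces x ∈ cdA + cbA. They hold because z is a nonzero prime,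
a² ≡ −w modulo z, and y is regular modulo (z, w). Exactness at the two middle terms then follows by
solving the equations one row at a time, the relations of `A` supplying the remaining entries. At
the right end, every path of positive length ending at M has d, a or b as its leftmost arrow. -/

noncomputable section

/-! ### Universal property and generators of the path algebra -/

namespace PathAlgebra

variable {k V E : Type} [Field k] [Quiver.{0} V] [Ring E] [Algebra k E]

/-- The product in `E` of the images of the arrows of a path, starting from the image of the trivial
path at its source. -/
def evalPath (ε : V → E) (g : ∀ {i j : V}, (i ⟶ j) → E) {i : V} :
    ∀ {j : V}, Quiver.Path i j → E
  | _, .nil => ε i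
  | _, .cons p f => g f * evalPath ε g p

section Lift

variable {ε : V → E} {g : ∀ {i j : V}, (i ⟶ j) → E}

/-- The product ends with `ε i` on the right, so no compatibility of `g` with the source idempotents
is needed. -/
theorem evalPath_mul_idem (hε : ∀ v, ε v * ε v = ε v) {i j : V} (p : Quiver.Path i j) :
    evalPath ε g p * ε i = evalPath ε g p := by
  induction p with
  | nil => exact hε i
  | cons p f ih => rw [evalPath, mul_assoc, ih]

theorem idem_mul_evalPath (hε : ∀ v, ε v * ε v = ε v)
    (hl : ∀ {i j : V} (f : i ⟶ j), ε j * g f = g f) {i j : V} (p : Quiver.Path i j) :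
    ε j * evalPath ε g p = evalPath ε g p := by
  cases p with
  | nil => exact hε i
  | cons p f => rw [evalPath, ← mul_assoc, hl]

theorem evalPath_comp (hε : ∀ v, ε v * ε v = ε v)
    (hl : ∀ {i j : V} (f : i ⟶ j), ε j * g f = g f)
    {i j l : V} (q : Quiver.Path i j) (p : Quiver.Path j l) :
    evalPath ε g (q.comp p) = evalPath ε g p * evalPath ε g q := by
  induction p with
  | nil => rw [Quiver.Path.comp_nil, evalPath, idem_mul_evalPath hε hl]
  | cons p f ih => rw [Quiver.Path.comp_cons, evalPath, evalPath, ih, mul_assoc]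

variable (k ε g) in
/-- The linear extension of `evalPath` to the path algebra. -/
def evalLinear : PathAlgebra k V →ₗ[k] E :=
  Finsupp.lift E k (QuiverPath V) fun p => evalPath ε g p.path

theorem evalLinear_ofPath (p : QuiverPath V) :
    evalLinear k ε g (ofPath k p) = evalPath ε g p.path := by
  refine (Finsupp.lift_apply _ _ _ _ _).trans ?_
  refine (Finsupp.sum_single_index ?_).trans (one_smul k _)
  exact zero_smul k _

theorem evalLinear_mul (hε : ∀ v, ε v * ε v = ε v) (hne : ∀ v w, v ≠ w → ε v * ε w = 0)
    (hl : ∀ {i j : V} (f : i ⟶ j), ε j * g f = g f) (x y : PathAlgebra k V) :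
    evalLinear k ε g (x * y) = evalLinear k ε g x * evalLinear k ε g y := by
  induction x using induction_paths with
  | zero => simp only [zero_mul', map_zero, zero_mul]
  | add x x' hx hx' => simp only [add_mul', map_add, hx, hx', add_mul]
  | smul_path r p =>
    induction y using induction_paths with
    | zero => simp only [mul_zero', map_zero, mul_zero]
    | add y y' hy hy' => simp only [mul_add', map_add, hy, hy', mul_add]
    | smul_path s q =>
      suffices h : evalLinear k ε g (ofPath k p * ofPath k q)
          = evalLinear k ε g (ofPath k p) * evalLinear k ε g (ofPath k q) by
        simp only [smul_mul', mul_smul', map_smul, h, smul_mul_assoc, mul_smul_comm]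
      obtain ⟨p₁, p₂, p⟩ := p
      obtain ⟨q₁, q₂, q⟩ := q
      by_cases hpq : q₂ = p₁
      · subst hpq
        rw [ofPath_mul_ofPath_comp, evalLinear_ofPath, evalLinear_ofPath, evalLinear_ofPath]
        exact evalPath_comp hε hl q p
      -- For paths that cannot be composed, the idempotents at the two unequal endpoints are
      -- inserted between the factors, where they annihilate each other.
      · rw [ofPath_mul_ofPath_ne hpq, map_zero, evalLinear_ofPath, evalLinear_ofPath,
          ← evalPath_mul_idem hε p, ← idem_mul_evalPath hε hl q, mul_assoc, ← mul_assoc (ε p₁),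
          hne _ _ (Ne.symm hpq), zero_mul, mul_zero]

/-- The universal property of the path algebra: a homomorphism to `E` is given by orthogonal
idempotents with sum `1` and by elements of the corresponding Peirce components. -/
def lift [Fintype V] (ε : V → E) (g : ∀ {i j : V}, (i ⟶ j) → E) (hε : ∀ v, ε v * ε v = ε v)
    (hne : ∀ v w, v ≠ w → ε v * ε w = 0) (hone : ∑ v, ε v = 1)
    (hl : ∀ {i j : V} (f : i ⟶ j), ε j * g f = g f) : PathAlgebra k V →ₐ[k] E :=
  AlgHom.ofLinearMap (evalLinear k ε g)
    (by
      rw [one_def, map_sum, ← hone]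
      exact Finset.sum_congr rfl fun v _ => evalLinear_ofPath _)
    (evalLinear_mul hε hne hl)

variable [Fintype V] (hε : ∀ v, ε v * ε v = ε v)
    (hne : ∀ v w, v ≠ w → ε v * ε w = 0) (hone : ∑ v, ε v = 1)
    (hl : ∀ {i j : V} (f : i ⟶ j), ε j * g f = g f)

theorem lift_idem (v : V) : lift (k := k) ε g hε hne hone hl (idem k v) = ε v :=
  evalLinear_ofPath _

/-- A one-arrow path evaluates to `g f * ε i`; `hr` removes the last factor. -/
theorem lift_ofArrow (hr : ∀ {i j : V} (f : i ⟶ j), g f * ε i = g f) {i j : V} (f : i ⟶ j) :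
    lift (k := k) ε g hε hne hone hl (ofArrow k f) = g f :=
  (evalLinear_ofPath _).trans (hr f)

end Lift

/-- The path algebra is generated by the trivial paths and the arrows. -/
theorem subalgebra_eq_top [Fintype V] (B : Subalgebra k (PathAlgebra k V))
    (hidem : ∀ v, idem k v ∈ B) (harrow : ∀ {i j : V} (f : i ⟶ j), ofArrow k f ∈ B) : B = ⊤ := by
  refine Algebra.eq_top_iff.2 fun x => ?_
  induction x using induction_paths with
  | zero => exact B.zero_mem
  | add x y hx hy => exact B.add_mem hx hy
  | smul_path r p =>
    refine B.smul_mem ?_ r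
    obtain ⟨i, j, p⟩ := p
    induction p with
    | nil => exact hidem i
    | cons p f ih =>
      have h := B.mul_mem (harrow f) ih
      rwa [ofArrow, ofPath_mul_ofPath_comp] at h

end PathAlgebra

/-! ### Generators and relations of the quotient algebra -/

namespace MorrisonPinkham

/-- The algebra is generated by the trivial paths and the four arrows. -/
theorem subalgebra_eq_top {lam : ℂ} (B : Subalgebra ℂ (Alg lam)) (he : ∀ v, e lam v ∈ B)
    (ha : a lam ∈ B) (hb : b lam ∈ B) (hc : c lam ∈ B) (hd : d lam ∈ B) : B = ⊤ := by
  have h := PathAlgebra.subalgebra_eq_top (B.comap (RingQuot.mkAlgHom ℂ (Rel lam))) he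
    (by rintro i j (_ | _ | _ | _) <;> assumption)
  refine eq_top_iff.2 fun x _ => ?_
  obtain ⟨x, rfl⟩ := RingQuot.mkAlgHom_surjective ℂ (Rel lam) x
  have hx : x ∈ B.comap (RingQuot.mkAlgHom ℂ (Rel lam)) := h ▸ trivial
  exact hx

section Relations

variable (lam : ℂ)

theorem e_mul_e_self (v : Vertex) : e lam v * e lam v = e lam v := by
  rw [e, ← map_mul]
  exact congrArg _ (PathAlgebra.ofPath_mul_ofPath_comp _ _)

theorem e_mul_e_of_ne {v w : Vertex} (h : v ≠ w) : e lam v * e lam w = 0 := by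
  rw [e, e, ← map_mul, ← map_zero (RingQuot.mkAlgHom ℂ (Rel lam))]
  exact congrArg _ (PathAlgebra.ofPath_mul_ofPath_ne h.symm)

theorem one_eq_add : (1 : Alg lam) = e lam .M + e lam .R := by
  rw [← map_one (RingQuot.mkAlgHom ℂ (Rel lam)), PathAlgebra.one_def, map_sum, add_comm]
  exact Finset.sum_pair (by decide)

theorem arrow_mul_e {i j : Vertex} (f : Arrow i j) :
    RingQuot.mkAlgHom ℂ (Rel lam) (arrow f) * e lam i
      = RingQuot.mkAlgHom ℂ (Rel lam) (arrow f) := by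
  rw [e, ← map_mul]
  exact congrArg _ (PathAlgebra.ofPath_mul_ofPath_comp _ _)

theorem a_mul_e : a lam * e lam .M = a lam := arrow_mul_e lam .a

theorem b_mul_e : b lam * e lam .M = b lam := arrow_mul_e lam .b

theorem c_mul_e : c lam * e lam .M = c lam := arrow_mul_e lam .c

theorem d_mul_e : d lam * e lam .R = d lam := arrow_mul_e lam .d

theorem relation_d : b lam * b lam * d lam + d lam * c lam * d lam = 0 := by
  have h := RingQuot.mkAlgHom_rel ℂ (Rel.rel_c (lam := lam))
  simp only [map_mul, map_add, map_pow, map_zero] at h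
  rw [← add_mul, ← pow_two]
  exact h

theorem relation_c : c lam * b lam * b lam + c lam * d lam * c lam = 0 := by
  have h := RingQuot.mkAlgHom_rel ℂ (Rel.rel_d (lam := lam))
  simp only [map_mul, map_add, map_pow, map_zero] at h
  rw [mul_assoc, mul_assoc, ← mul_add, ← pow_two]
  exact h

theorem relation_ab : a lam * b lam + b lam * a lam = 0 := by
  have h := RingQuot.mkAlgHom_rel ℂ (Rel.rel_a (lam := lam))
  simp only [map_mul, map_add, map_zero] at h
  exact h

theorem relation_a_sq : a lam * a lam + b lam * d lam * c lam + d lam * c lam * b lam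
    + algebraMap ℂ (Alg lam) lam * (b lam * b lam) + b lam * b lam * b lam = 0 := by
  have h := RingQuot.mkAlgHom_rel ℂ (Rel.rel_b (lam := lam))
  simp only [map_mul, map_add, map_pow, map_zero, map_smul] at h
  rw [← Algebra.smul_def, ← pow_two, ← pow_two, ← pow_succ]
  exact h

end Relations

end MorrisonPinkham

end

noncomputable section

/-! ### Consequences of the relations in an arbitrary ring, with `l` in the role of λ -/

namespace MorrisonPinkham

section Identities

variable {A : Type} [Ring A] {a b c d l : A}

theorem comm_a_sq_b (h₃ : a * b + b * a = 0) : a * (b * b) = b * b * a := by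
  linear_combination (norm := noncomm_ring) h₃ * b - b * h₃

/-- Both sides equal −dcdc. -/
theorem comm_dc_sq_b (h₁ : b * b * d + d * c * d = 0) (h₂ : c * b * b + c * d * c = 0) :
    b * b * (d * c) = d * c * (b * b) := by
  linear_combination (norm := noncomm_ring) h₁ * c - d * h₂

/-- The relation `h₄` says w = −a² − l b², and a commutes with each of a², l and b². -/
theorem comm_a_w (hl : a * l = l * a) (h₃ : a * b + b * a = 0)
    (h₄ : a * a + b * d * c + d * c * b + l * (b * b) + b * b * b = 0) :
    a * (d * c * b + b * d * c + b * b * b) = (d * c * b + b * d * c + b * b * b) * a := by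
  linear_combination (norm := noncomm_ring)
    a * h₄ - h₄ * a - l * comm_a_sq_b h₃ - hl * (b * b)

/-- The two sides differ by b²dc − dcb². -/
theorem comm_b_w (h₁ : b * b * d + d * c * d = 0) (h₂ : c * b * b + c * d * c = 0) :
    b * (d * c * b + b * d * c + b * b * b) = (d * c * b + b * d * c + b * b * b) * b := by
  linear_combination (norm := noncomm_ring) comm_dc_sq_b h₁ h₂

/-- Here ay − ya = [a², dc] + [a, b²]a. After substituting `h₄` for a², the relations give [bdc +
dcb, dc] = −[b³, dc], which cancels the b³ term, and dc commutes with l and with b². -/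
theorem comm_a_y (hl : d * c * l = l * (d * c)) (h₁ : b * b * d + d * c * d = 0)
    (h₂ : c * b * b + c * d * c = 0) (h₃ : a * b + b * a = 0)
    (h₄ : a * a + b * d * c + d * c * b + l * (b * b) + b * b * b = 0) :
    a * (d * c * a + a * d * c + b * b * a) = (d * c * a + a * d * c + b * b * a) * a := by
  linear_combination (norm := noncomm_ring) comm_a_sq_b h₃ * a + h₄ * (d * c) - d * c * h₄
    - b * h₁ * c + d * h₂ * b - l * comm_dc_sq_b h₁ h₂ + hl * (b * b)

/-- Since a and b anticommute, by − yb equals wa − aw, which vanishes by `comm_a_w`. -/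
theorem comm_b_y (hl : a * l = l * a) (h₃ : a * b + b * a = 0)
    (h₄ : a * a + b * d * c + d * c * b + l * (b * b) + b * b * b = 0) :
    b * (d * c * a + a * d * c + b * b * a) = (d * c * a + a * d * c + b * b * a) * b := by
  linear_combination (norm := noncomm_ring) -comm_a_w hl h₃ h₄ + h₃ * (d * c) - d * c * h₃
    + h₃ * b * b - b * h₃ * b

theorem c_mul_y (h₂ : c * b * b + c * d * c = 0) :
    c * (d * c * a + a * d * c + b * b * a) = c * a * d * c := by
  linear_combination (norm := noncomm_ring) h₂ * a

theorem y_mul_d (h₁ : b * b * d + d * c * d = 0) (h₃ : a * b + b * a = 0) :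
    (d * c * a + a * d * c + b * b * a) * d = d * c * a * d := by
  linear_combination (norm := noncomm_ring) a * h₁ - comm_a_sq_b h₃ * d

theorem c_mul_w (h₂ : c * b * b + c * d * c = 0) :
    c * (d * c * b + b * d * c + b * b * b) = c * b * d * c := by
  linear_combination (norm := noncomm_ring) h₂ * b

theorem w_mul_d (h₁ : b * b * d + d * c * d = 0) :
    (d * c * b + b * d * c + b * b * b) * d = d * c * b * d := by
  linear_combination (norm := noncomm_ring) b * h₁

/-- This is c(aw − wa) = 0 rearranged. In central terms the right side is −z·cba − w·ca + y·cb,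
which puts cbadc into the span of the chosen generators of e_R A. -/
theorem cbadc_eq (hl : a * l = l * a) (h₂ : c * b * b + c * d * c = 0)
    (h₃ : a * b + b * a = 0)
    (h₄ : a * a + b * d * c + d * c * b + l * (b * b) + b * b * b = 0) :
    c * b * a * d * c = c * d * c * b * a - c * b * d * c * a + c * a * d * c * b := by
  linear_combination (norm := noncomm_ring) -(c * comm_a_w hl h₃ h₄) + c * h₃ * (d * c)
    + c * comm_a_sq_b h₃ * b + c * b * b * h₃ - 2 * h₂ * b * a

/-- This is by = yb solved for dcba; the right side is w·a − y·b + badc, in the span of the chosen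
generators of e_M A. -/
theorem dcba_eq (hl : a * l = l * a) (h₃ : a * b + b * a = 0)
    (h₄ : a * a + b * d * c + d * c * b + l * (b * b) + b * b * b = 0) :
    d * c * b * a = (d * c * b + b * d * c + b * b * b) * a
      - (d * c * a + a * d * c + b * b * a) * b + b * a * d * c := by
  linear_combination (norm := noncomm_ring) -comm_b_y hl h₃ h₄

end Identities

end MorrisonPinkham

end

noncomputable section

namespace MorrisonPinkham

/-! ## An explicit left module -/

/-- The coordinate ring `ℂ[z, w, y]` of the central subalgebra. -/
abbrev Coeff : Type := MvPolynomial (Fin 3) ℂ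

open MvPolynomial in
/-- The coordinate of `a ^ 2`. -/
def aSq (lam : ℂ) : Coeff := -X 1 - C lam * X 0

/-- The coordinates of `e_M A`: the entry `v k l` belongs to the product of the `l`-th element of
`e_M, b, a, b a` and the `k`-th element of `e_M, d c, d`. -/
abbrev ModelM : Type := Fin 3 → Fin 4 → Coeff

/-- The coordinates of `e_R A` with respect to `c, c a, c b, c b a, e_R, c b a d`. -/
abbrev ModelR : Type := Fin 6 → Coeff

open MvPolynomial in
/-- Left multiplication by `b` in coordinates. -/
def modelB : ModelM →ₗ[ℂ] ModelM where
  toFun v k := ![X 0 * v k 1, v k 0, X 0 * v k 3, v k 2]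
  map_add' u v := by ext1 k; ext1 l; fin_cases l <;> simp [mul_add]
  map_smul' r v := by ext1 k; ext1 l; fin_cases l <;> simp

/-- Left multiplication by `a` in coordinates. -/
def modelA (lam : ℂ) : ModelM →ₗ[ℂ] ModelM where
  toFun v k := ![aSq lam * v k 2, -(aSq lam * v k 3), v k 0, -v k 1]
  map_add' u v := by ext1 k; ext1 l; fin_cases l <;> simp [mul_add, add_comm]
  map_smul' r v := by ext1 k; ext1 l; fin_cases l <;> simp

open MvPolynomial in
/-- Left multiplication by `c` in coordinates. -/
def modelC : ModelM →ₗ[ℂ] ModelR where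
  toFun v := ![v 0 0 - X 0 * v 1 0 + X 1 * v 1 1 + X 2 * v 1 2, v 0 2 - X 1 * v 1 3,
    v 0 1 + X 2 * v 1 3, v 0 3 - X 0 * v 1 3,
    -(X 0 * v 2 0) + X 1 * v 2 1 + X 2 * v 2 2, v 2 3]
  map_add' u v := by ext1 i; fin_cases i <;> simp <;> ring
  map_smul' r v := by
    ext1 i; fin_cases i <;> simp [MvPolynomial.smul_eq_C_mul] <;> ring

open MvPolynomial in
/-- Left multiplication by `d` in coordinates. -/
def modelD : ModelR →ₗ[ℂ] ModelM where
  toFun r := ![![X 2 * r 1 + X 1 * r 2, -(X 0 * r 2) - X 2 * r 3, -(X 0 * r 1) + X 1 * r 3, 0],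
    ![r 0, -r 2, -r 1, r 3], ![r 4, -(X 2 * r 5), X 1 * r 5, -(X 0 * r 5)]]
  map_add' u v := by
    ext1 k; ext1 l; fin_cases k <;> fin_cases l <;> simp <;> ring
  map_smul' r v := by
    ext1 k; ext1 l; fin_cases k <;> fin_cases l <;> simp [MvPolynomial.smul_eq_C_mul] <;> ring

section Relations

open MvPolynomial

theorem modelA_modelB (lam : ℂ) (v : ModelM) :
    modelA lam (modelB v) = -modelB (modelA lam v) := by
  ext1 k; ext1 l; fin_cases l <;> simp [modelA, modelB, mul_left_comm]

theorem modelB_modelB (v : ModelM) : modelB (modelB v) = (X 0 : Coeff) • v := by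
  ext1 k; ext1 l; fin_cases l <;> simp [modelB]

theorem modelA_modelA (lam : ℂ) (v : ModelM) :
    modelA lam (modelA lam v) = aSq lam • v := by
  ext1 k; ext1 l; fin_cases l <;> simp [modelA]

theorem modelC_modelD (r : ModelR) : modelC (modelD r) = -((X 0 : Coeff) • r) := by
  ext1 i; fin_cases i <;> simp [modelC, modelD] <;> ring

theorem modelC_modelB_modelD (r : ModelR) :
    modelC (modelB (modelD r)) = (X 1 : Coeff) • r := by
  ext1 i; fin_cases i <;> simp [modelC, modelD, modelB] <;> ring

/-- This is the scalar action of w = dcb + bdc + b³, solved for bdc so that it serves as a rewriting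
rule. -/
theorem modelB_modelD_modelC (v : ModelM) : modelB (modelD (modelC v))
    = (X 1 : Coeff) • v - modelD (modelC (modelB v)) - modelB (modelB (modelB v)) := by
  ext1 k; ext1 l
  simp only [Pi.sub_apply, Pi.smul_apply]
  fin_cases k <;> fin_cases l <;> simp [modelC, modelD, modelB] <;> ring

theorem modelD_smul (f : Coeff) (r : ModelR) : modelD (f • r) = f • modelD r := by
  ext1 k; ext1 l; fin_cases k <;> fin_cases l <;> simp [modelD] <;> ring

theorem modelC_smul (f : Coeff) (v : ModelM) : modelC (f • v) = f • modelC v := by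
  ext1 i; fin_cases i <;> simp [modelC] <;> ring

end Relations

/-- The underlying space of the model of the left regular module. -/
abbrev Model : Type := ModelM × ModelR

open LinearMap in
/-- The action of the trivial paths on the model. -/
def modelIdem : Vertex → Module.End ℂ Model
  | .M => inl ℂ ModelM ModelR ∘ₗ fst ℂ ModelM ModelR
  | .R => inr ℂ ModelM ModelR ∘ₗ snd ℂ ModelM ModelR

open LinearMap in
/-- The action of the arrows on the model. -/
def modelArrow (lam : ℂ) : ∀ {i j : Vertex}, (i ⟶ j) → Module.End ℂ Model
  | _, _, Arrow.a => inl ℂ ModelM ModelR ∘ₗ modelA lam ∘ₗ fst ℂ ModelM ModelR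
  | _, _, Arrow.b => inl ℂ ModelM ModelR ∘ₗ modelB ∘ₗ fst ℂ ModelM ModelR
  | _, _, Arrow.c => inr ℂ ModelM ModelR ∘ₗ modelC ∘ₗ fst ℂ ModelM ModelR
  | _, _, Arrow.d => inl ℂ ModelM ModelR ∘ₗ modelD ∘ₗ snd ℂ ModelM ModelR

theorem modelIdem_mul_modelArrow (lam : ℂ) {i j : Vertex} (f : i ⟶ j) :
    modelIdem j * modelArrow lam f = modelArrow lam f := by
  rcases f with _ | _ | _ | _ <;> rfl

/-- The action of the path algebra on the model. -/
def freeAction (lam : ℂ) : FreePaths →ₐ[ℂ] Module.End ℂ Model :=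
  PathAlgebra.lift modelIdem (modelArrow lam)
    (by rintro (_ | _) <;> rfl)
    (by
      rintro (_ | _) (_ | _) h
      · exact absurd rfl h
      · rfl
      · rfl
      · exact absurd rfl h)
    (by
      refine (Finset.sum_pair (by decide)).trans (LinearMap.ext fun v => ?_)
      exact Prod.ext (zero_add _) (add_zero _))
    (modelIdem_mul_modelArrow lam)

theorem freeAction_arrow (lam : ℂ) {i j : Vertex} (f : Arrow i j) :
    freeAction lam (arrow f) = modelArrow lam (i := i) (j := j) f :=
  PathAlgebra.lift_ofArrow (V := Vertex) _ _ _ (modelIdem_mul_modelArrow lam)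
    (by rintro _ _ (_ | _ | _ | _) <;> rfl) f

theorem freeAction_rel (lam : ℂ) ⦃x y : FreePaths⦄ (h : Rel lam x y) :
    freeAction lam x = freeAction lam y := by
  have hz (v : ModelM) : modelC (modelB (modelB v)) = -modelC (modelD (modelC v)) := by
    rw [modelB_modelB, modelC_smul, modelC_modelD, neg_neg]
  have hz' (r : ModelR) : modelB (modelB (modelD r)) = -modelD (modelC (modelD r)) := by
    rw [modelB_modelB, modelC_modelD, map_neg, modelD_smul, neg_neg]
  cases h <;> refine LinearMap.ext fun v => Prod.ext ?_ ?_ <;>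
    simp only [map_add, map_mul, map_smul, map_zero, freeAction_arrow, pow_succ, pow_zero,
      one_mul]
  all_goals simp [modelArrow, hz, hz', modelA_modelB, modelB_modelD_modelC, modelA_modelA]
  -- What remains is the M component of the relation for a². With b² = z it becomes the defining
  -- formula of `aSq`.
  ext1 k; ext1 l
  have h := congrFun (congrFun (modelB_modelB v.1) k) l
  simp only [Pi.smul_apply, smul_eq_mul] at h
  simp [aSq, MvPolynomial.smul_eq_C_mul, h]
  ring

/-- The action of the algebra on the model. -/
def action (lam : ℂ) : Alg lam →ₐ[ℂ] Module.End ℂ Model :=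
  RingQuot.liftAlgHom ℂ ⟨freeAction lam, freeAction_rel lam⟩

section Action

variable (lam : ℂ) (v : Model)

theorem action_mk (x : FreePaths) :
    action lam (RingQuot.mkAlgHom ℂ (Rel lam) x) = freeAction lam x :=
  RingQuot.liftAlgHom_mkAlgHom_apply _ _ _ _

theorem action_e (i : Vertex) : action lam (e lam i) = modelIdem i :=
  (action_mk lam _).trans (PathAlgebra.lift_idem (V := Vertex) _ _ _ (modelIdem_mul_modelArrow lam) i)

theorem action_a : action lam (a lam) v = (modelA lam v.1, 0) :=
  congrArg (· v) ((action_mk lam _).trans (freeAction_arrow lam .a))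

theorem action_b : action lam (b lam) v = (modelB v.1, 0) :=
  congrArg (· v) ((action_mk lam _).trans (freeAction_arrow lam .b))

theorem action_c : action lam (c lam) v = (0, modelC v.1) :=
  congrArg (· v) ((action_mk lam _).trans (freeAction_arrow lam .c))

theorem action_d : action lam (d lam) v = (modelD v.2, 0) :=
  congrArg (· v) ((action_mk lam _).trans (freeAction_arrow lam .d))

end Action

/-! ## Regularity in the model -/

section Regularity

open MvPolynomial

/-- The square of b is the scalar z, a nonzero element of a domain. -/
theorem modelB_injective : Function.Injective modelB := by
  refine (injective_iff_map_eq_zero _).2 fun v hv => ?_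
  have h := modelB_modelB v
  rw [hv, map_zero] at h
  ext1 k; ext1 l
  have hkl := (congrFun (congrFun h k) l).symm
  exact (mul_eq_zero.1 hkl).resolve_left (X_ne_zero 0)

/-- The element z is prime and `aSq` ≡ −w modulo z; evaluation at (0, 1, 0) shows that z does not
divide w. -/
theorem X_zero_dvd_of_dvd_aSq_mul {lam : ℂ} {f : Coeff} (h : X 0 ∣ aSq lam * f) : X 0 ∣ f := by
  have hp : Prime (X 0 : Coeff) := X_prime
  refine (hp.dvd_or_dvd h).resolve_left fun h' => ?_
  have h₁ : (X 0 : Coeff) ∣ X 1 := by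
    have : (X 1 : Coeff) = -(aSq lam) - C lam * X 0 := by rw [aSq]; ring
    rw [this]
    exact dvd_sub (dvd_neg.2 h') (dvd_mul_left _ _)
  obtain ⟨g, hg⟩ := h₁
  simpa using congrArg (eval ![0, 1, 0]) hg

theorem exists_modelB_of_modelA {lam : ℂ} {u v : ModelM} (h : modelA lam v = modelB u) :
    ∃ v', v = modelB v' := by
  have h₂ (k : Fin 3) : X 0 ∣ v k 2 := by
    have hk : aSq lam * v k 2 = X 0 * u k 1 := congrFun (congrFun h k) 0
    exact X_zero_dvd_of_dvd_aSq_mul ⟨_, hk⟩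
  choose q hq using h₂
  -- An entry list lies in the image of b as soon as its entries 0 and 2 are divisible by z. Entry 0
  -- of `v` is z · `u k 3` by the a-coordinate of `h`; entry 2 is `hq`.
  refine ⟨fun k => ![v k 1, u k 3, v k 3, q k], ?_⟩
  ext1 k; ext1 l
  fin_cases l
  · exact congrFun (congrFun h k) 2
  · rfl
  · exact hq k
  · rfl

/-- Rows 1 and 2 of the matrix of d contain every coordinate by itself, up to sign and, for the last
one, a factor z. -/
theorem modelD_injective : Function.Injective modelD := by
  refine (injective_iff_map_eq_zero _).2 fun r hr => ?_
  have h (k : Fin 3) (l : Fin 4) : modelD r k l = 0 := by rw [hr]; rfl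
  ext1 i
  fin_cases i
  · exact h 1 0
  · exact neg_eq_zero.1 (h 1 2)
  · exact neg_eq_zero.1 (h 1 1)
  · exact h 1 3
  · exact h 2 0
  · exact (mul_eq_zero.1 (neg_eq_zero.1 (h 2 3))).resolve_left (X_ne_zero 0)

/-- The quotient map `ℂ[z, w, y] → ℂ[z, w, y] / (z, w)`, followed by the canonical section. -/
def dropZW : Coeff →ₐ[ℂ] Coeff := aeval ![0, 0, X 2]

theorem exists_of_dropZW_eq_zero {f : Coeff} (h : dropZW f = 0) :
    ∃ p q, f = X 0 * p + X 1 * q := by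
  -- The stronger claim, that every polynomial is congruent to its image modulo (z, w), is stable
  -- under sums and products with variables.
  suffices h' : ∀ f : Coeff, f - dropZW f ∈ Ideal.span {X 0, X 1} by
    have hf := h' f
    rw [h, sub_zero, Ideal.mem_span_pair] at hf
    obtain ⟨p, q, hpq⟩ := hf
    exact ⟨p, q, by rw [← hpq]; ring⟩
  intro f
  induction f using MvPolynomial.induction_on with
  | C r => simp [dropZW]
  | add f g hf hg =>
    rw [map_add, add_sub_add_comm]
    exact add_mem hf hg
  | mul_X f i hf =>
    have hX : (X i : Coeff) - dropZW (X i) ∈ Ideal.span {(X 0 : Coeff), X 1} := by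
      fin_cases i
      · exact Ideal.subset_span (by simp [dropZW])
      · exact Ideal.subset_span (by simp [dropZW])
      · simp [dropZW]
    have : f * X i - dropZW (f * X i)
        = (X i : Coeff) * (f - dropZW f) + dropZW f * (X i - dropZW (X i)) := by
      rw [map_mul]; ring
    rw [this]
    exact add_mem (Ideal.mul_mem_left _ _ hf) (Ideal.mul_mem_left _ _ hX)

/-- On e_R A, cd = −z and cbd = w, so multiples of z and w are always reached. The coordinates at
cb, cba and cbad are reached through cb directly. Only those at c, ca and e_R have to be shown to
lie in (z, w). -/
theorem exists_modelC_of_modelD {lam : ℂ} {r : ModelR} {u v : ModelM}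
    (h : modelD r = modelA lam u + modelB v) :
    ∃ p q, r = modelC (modelD p) + modelC (modelB q) := by
  -- The e_M entries of au + bv are combinations of `aSq` = −w − λz and z.
  have hk (k : Fin 3) : dropZW (modelD r k 0) = 0 := by
    rw [h]
    simp [modelA, modelB, dropZW, aSq]
  obtain ⟨p₀, q₀, h₀⟩ := exists_of_dropZW_eq_zero (f := r 0) (hk 1)
  obtain ⟨p₄, q₄, h₄⟩ := exists_of_dropZW_eq_zero (f := r 4) (hk 2)
  obtain ⟨p₁, q₁, h₁⟩ : ∃ p q, r 1 = X 0 * p + X 1 * q := by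
    have h' := hk 0
    refine exists_of_dropZW_eq_zero ?_
    -- The relevant entry is y r₁ + w r₂, and y survives modulo (z, w).
    have h'' : (X 2 : Coeff) * dropZW (r 1) = 0 := by
      simpa [modelD, dropZW] using h'
    exact (mul_eq_zero.1 h'').resolve_left (X_ne_zero 2)
  -- The signs come from cd = −z. The second summand of `q` stands for r₂ e_M + r₃ a + r₅ ad, which
  -- cb sends to r₂ cb + r₃ cba + r₅ cbad.
  refine ⟨![-p₀, -p₁, 0, 0, -p₄, 0], modelD ![q₀, q₁, 0, 0, q₄, 0]
    + ![![r 2, 0, r 3, 0], 0, ![0, 0, r 5, 0]], ?_⟩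
  rw [map_add, map_add, modelC_modelD, modelC_modelB_modelD]
  ext1 i
  fin_cases i <;> simp [modelC, modelB, h₀, h₁, h₄]

end Regularity

end MorrisonPinkham

end

noncomputable section

namespace MorrisonPinkham

/-! ## Central elements -/

section Central

variable (lam : ℂ)

theorem mul_eq_zero_of_ne {lam : ℂ} {v w : Vertex} {x y : Alg lam} (hx : x * e lam v = x)
    (hy : e lam w * y = y) (h : v ≠ w) : x * y = 0 := by
  rw [← hx, ← hy, mul_assoc, ← mul_assoc (e lam v), e_mul_e_of_ne lam h, zero_mul, mul_zero]

theorem algebraMap_comm (x : Alg lam) : x * algebraMap ℂ _ lam = algebraMap ℂ _ lam * x :=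
  (Algebra.commutes lam x).symm

/-- The sum of an element of `e_M A e_M` and an element of `e_R A e_R` is central if it commutes
with the four arrows. -/
theorem add_mem_center {x y : Alg lam} (hx : e lam .M * x = x) (hx' : x * e lam .M = x)
    (hy : e lam .R * y = y) (hy' : y * e lam .R = y) (ha : a lam * x = x * a lam)
    (hb : b lam * x = x * b lam) (hc : c lam * x = y * c lam) (hd : x * d lam = d lam * y) :
    x + y ∈ Subalgebra.center ℂ (Alg lam) := by
  have hxz {u : Alg lam} (hu : e lam .R * u = u) : x * u = 0 :=
    mul_eq_zero_of_ne hx' hu (by decide)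
  have hyz {u : Alg lam} (hu : e lam .M * u = u) : y * u = 0 :=
    mul_eq_zero_of_ne hy' hu (by decide)
  have hxz' {u : Alg lam} (hu : u * e lam .R = u) : u * x = 0 :=
    mul_eq_zero_of_ne hu hx (by decide)
  have hyz' {u : Alg lam} (hu : u * e lam .M = u) : u * y = 0 :=
    mul_eq_zero_of_ne hu hy (by decide)
  -- The centralizer is a subalgebra, so only the trivial paths and the arrows need checking.
  have h : Subalgebra.centralizer ℂ {x + y} = ⊤ := by
    refine subalgebra_eq_top _ ?_ ?_ ?_ ?_ ?_
    · rintro (_ | _) <;> rw [Subalgebra.mem_centralizer_iff] <;> rintro _ rfl <;>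
        rw [add_mul, mul_add]
      · rw [hxz (e_mul_e_self lam .R), hxz' (e_mul_e_self lam .R), hy, hy']
      · rw [hyz (e_mul_e_self lam .M), hyz' (e_mul_e_self lam .M), hx, hx']
    all_goals
      rw [Subalgebra.mem_centralizer_iff]
      rintro _ rfl
      rw [add_mul, mul_add]
    · rw [ha, hyz (e_mul_a lam), hyz' (a_mul_e lam)]
    · rw [hb, hyz (e_mul_b lam), hyz' (b_mul_e lam)]
    · rw [hc, hxz (e_mul_c lam), hyz' (c_mul_e lam), zero_add, add_zero]
    · rw [hd, hyz (e_mul_d lam), hxz' (d_mul_e lam), zero_add, add_zero]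
  rw [Subalgebra.mem_center_iff]
  intro u
  have hu : u ∈ Subalgebra.centralizer ℂ {x + y} := h ▸ Algebra.mem_top
  exact (Subalgebra.mem_centralizer_iff ℂ |>.1 hu _ rfl).symm

/-- The component at `M` of the central element `w`. -/
def wM : Alg lam := d lam * c lam * b lam + b lam * d lam * c lam + b lam * b lam * b lam

/-- The component at `M` of the central element `y`. -/
def yM : Alg lam := d lam * c lam * a lam + a lam * d lam * c lam + b lam * b lam * a lam

/-- Compatibility with c and d is exactly the pair of relations c(b² + dc) = 0 and (b² + dc)d = 0.
-/
theorem z_mem_center :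
    b lam * b lam + -(c lam * d lam) ∈ Subalgebra.center ℂ (Alg lam) := by
  refine add_mem_center lam ?_ ?_ ?_ ?_ (comm_a_sq_b (relation_ab lam)) (mul_assoc _ _ _).symm ?_ ?_
  · rw [← mul_assoc, e_mul_b]
  · rw [mul_assoc, b_mul_e]
  · rw [mul_neg, ← mul_assoc, e_mul_c]
  · rw [neg_mul, mul_assoc, d_mul_e]
  · linear_combination (norm := noncomm_ring) relation_c lam
  · linear_combination (norm := noncomm_ring) relation_d lam

theorem w_mem_center :
    wM lam + c lam * b lam * d lam ∈ Subalgebra.center ℂ (Alg lam) := by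
  refine add_mem_center lam ?_ ?_ ?_ ?_
    (comm_a_w (algebraMap_comm lam _) (relation_ab lam) (relation_a_sq lam))
    (comm_b_w (relation_d lam) (relation_c lam)) (c_mul_w (relation_c lam))
    ((w_mul_d (relation_d lam)).trans ?_)
  · simp only [wM, mul_add, ← mul_assoc, e_mul_d, e_mul_b]
  · simp only [wM, add_mul, mul_assoc, c_mul_e, b_mul_e]
  · simp only [← mul_assoc, e_mul_c]
  · simp only [mul_assoc, d_mul_e]
  · simp only [mul_assoc]

theorem y_mem_center :
    yM lam + c lam * a lam * d lam ∈ Subalgebra.center ℂ (Alg lam) := by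
  refine add_mem_center lam ?_ ?_ ?_ ?_
    (comm_a_y (algebraMap_comm lam _) (relation_d lam) (relation_c lam) (relation_ab lam)
      (relation_a_sq lam))
    (comm_b_y (algebraMap_comm lam _) (relation_ab lam) (relation_a_sq lam))
    (c_mul_y (relation_c lam)) ((y_mul_d (relation_d lam) (relation_ab lam)).trans ?_)
  · simp only [yM, mul_add, ← mul_assoc, e_mul_d, e_mul_b, e_mul_a]
  · simp only [yM, add_mul, mul_assoc, c_mul_e, a_mul_e]
  · simp only [← mul_assoc, e_mul_c]
  · simp only [mul_assoc, d_mul_e]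
  · simp only [mul_assoc]

/-- The evaluation of a polynomial at the three central elements. -/
def evalCentral : Coeff →ₐ[ℂ] Alg lam :=
  (Subalgebra.center ℂ (Alg lam)).val.comp
    (MvPolynomial.aeval ![⟨_, z_mem_center lam⟩, ⟨_, w_mem_center lam⟩, ⟨_, y_mem_center lam⟩])

/-- The algebra structure over the polynomial ring, given by the three central elements. -/
instance : Algebra Coeff (Alg lam) :=
  (evalCentral lam).toRingHom.toAlgebra' fun f x =>
    (Subalgebra.mem_center_iff.1 (SetLike.coe_mem (MvPolynomial.aeval _ f)) x).symm

theorem coeff_smul_def (f : Coeff) (x : Alg lam) : f • x = evalCentral lam f * x := rfl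

instance : IsScalarTower ℂ Coeff (Alg lam) :=
  IsScalarTower.of_algebraMap_eq fun r => ((evalCentral lam).commutes r).symm

open MvPolynomial

theorem evalCentral_z : evalCentral lam (X 0) = b lam * b lam + -(c lam * d lam) := by
  simp [evalCentral]

theorem evalCentral_w : evalCentral lam (X 1) = wM lam + c lam * b lam * d lam := by
  simp [evalCentral]

theorem evalCentral_y : evalCentral lam (X 2) = yM lam + c lam * a lam * d lam := by
  simp [evalCentral]

variable {lam} {x : Alg lam}

theorem d_mul_of_mem_M (hx : e lam .M * x = x) : d lam * x = 0 :=
  mul_eq_zero_of_ne (d_mul_e lam) hx (by decide)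

theorem z_smul_M (hx : e lam .M * x = x) : (X 0 : Coeff) • x = b lam * b lam * x := by
  rw [coeff_smul_def, evalCentral_z, add_mul, neg_mul, mul_assoc (c lam), d_mul_of_mem_M hx,
    mul_zero, neg_zero, add_zero]

theorem w_smul_M (hx : e lam .M * x = x) : (X 1 : Coeff) • x = wM lam * x := by
  rw [coeff_smul_def, evalCentral_w, add_mul, mul_assoc _ (d lam), d_mul_of_mem_M hx, mul_zero,
    add_zero]

theorem y_smul_M (hx : e lam .M * x = x) : (X 2 : Coeff) • x = yM lam * x := by
  rw [coeff_smul_def, evalCentral_y, add_mul, mul_assoc _ (d lam), d_mul_of_mem_M hx, mul_zero,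
    add_zero]

/-- On e_M A the relation for a² reads a² = −w − λz. -/
theorem aSq_smul_M (hx : e lam .M * x = x) : aSq lam • x = a lam * a lam * x := by
  have hC : (C lam : Coeff) • (b lam * b lam * x) = algebraMap ℂ _ lam * (b lam * b lam * x) :=
    congrArg (· * (b lam * b lam * x)) ((evalCentral lam).commutes lam)
  rw [aSq, sub_smul, neg_smul, mul_smul, z_smul_M hx, w_smul_M hx, wM, hC]
  linear_combination (norm := noncomm_ring) -relation_a_sq lam * x

theorem z_smul_R (hx : e lam .R * x = x) : (X 0 : Coeff) • x = -(c lam * d lam * x) := by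
  rw [coeff_smul_def, evalCentral_z, add_mul, neg_mul, mul_assoc (b lam),
    mul_eq_zero_of_ne (b_mul_e lam) hx (by decide), mul_zero, zero_add]

theorem w_smul_R (hx : e lam .R * x = x) : (X 1 : Coeff) • x = c lam * b lam * d lam * x := by
  rw [coeff_smul_def, evalCentral_w, add_mul, mul_eq_zero_of_ne (v := .M) _ hx (by decide),
    zero_add]
  simp only [wM, add_mul, mul_assoc, c_mul_e, b_mul_e]

theorem y_smul_R (hx : e lam .R * x = x) : (X 2 : Coeff) • x = c lam * a lam * d lam * x := by
  rw [coeff_smul_def, evalCentral_y, add_mul, mul_eq_zero_of_ne (v := .M) _ hx (by decide),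
    zero_add]
  simp only [yM, add_mul, mul_assoc, c_mul_e, a_mul_e]

end Central

/-! ## The realization of the model in the algebra -/

section Realize

variable (lam : ℂ)

open MvPolynomial

/-- The combination of `e_M, b, a, b a` with given coefficients. -/
def realizeColumn : (Fin 4 → Coeff) →ₗ[ℂ] Alg lam where
  toFun q := q 0 • e lam .M + q 1 • b lam + q 2 • a lam + q 3 • (b lam * a lam)
  map_add' p q := by simp only [Pi.add_apply]; module
  map_smul' r q := by simp only [Pi.smul_apply, smul_assoc, smul_add, RingHom.id_apply]

/-- The element of `e_M A` with given coordinates. -/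
def realizeM : ModelM →ₗ[ℂ] Alg lam where
  toFun v := realizeColumn lam (v 0) + realizeColumn lam (v 1) * (d lam * c lam)
    + realizeColumn lam (v 2) * d lam
  map_add' u v := by simp only [Pi.add_apply, map_add, add_mul]; abel
  map_smul' r v := by
    simp only [Pi.smul_apply, map_smul, smul_mul_assoc, smul_add, RingHom.id_apply]

/-- The element of `e_R A` with given coordinates. -/
def realizeR : ModelR →ₗ[ℂ] Alg lam where
  toFun r := r 0 • c lam + r 1 • (c lam * a lam) + r 2 • (c lam * b lam)
    + r 3 • (c lam * (b lam * a lam)) + r 4 • e lam .R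
    + r 5 • (c lam * (b lam * (a lam * d lam)))
  map_add' p q := by simp only [Pi.add_apply]; module
  map_smul' r q := by simp only [Pi.smul_apply, smul_assoc, smul_add, RingHom.id_apply]

theorem realizeColumn_apply (q : Fin 4 → Coeff) : realizeColumn lam q
    = q 0 • e lam .M + q 1 • b lam + q 2 • a lam + q 3 • (b lam * a lam) := rfl

theorem realizeM_apply (v : ModelM) : realizeM lam v = realizeColumn lam (v 0)
    + realizeColumn lam (v 1) * (d lam * c lam) + realizeColumn lam (v 2) * d lam := rfl

theorem realizeR_apply (r : ModelR) : realizeR lam r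
    = r 0 • c lam + r 1 • (c lam * a lam) + r 2 • (c lam * b lam)
      + r 3 • (c lam * (b lam * a lam)) + r 4 • e lam .R
      + r 5 • (c lam * (b lam * (a lam * d lam))) := rfl

/-- The span of e_M, b, a, ba over the central polynomials is stable under left multiplication by b
and by a, so these act on each column without touching the right factors e_M, dc, d. -/
theorem b_mul_realizeColumn (q : Fin 4 → Coeff) : b lam * realizeColumn lam q
    = realizeColumn lam ![X 0 * q 1, q 0, X 0 * q 3, q 2] := by
  have h₁ : b lam * b lam = (X 0 : Coeff) • e lam .M := by
    rw [z_smul_M (e_mul_e_self lam .M), mul_assoc, b_mul_e]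
  have h₂ : b lam * (b lam * a lam) = (X 0 : Coeff) • a lam := by
    rw [z_smul_M (e_mul_a lam), mul_assoc]
  simp only [realizeColumn_apply, mul_add, mul_smul_comm, Matrix.cons_val, b_mul_e, h₁, h₂]
  module

theorem a_mul_realizeColumn (q : Fin 4 → Coeff) : a lam * realizeColumn lam q
    = realizeColumn lam ![aSq lam * q 2, -(aSq lam * q 3), q 0, -q 1] := by
  have h₁ : a lam * b lam = -(b lam * a lam) := eq_neg_of_add_eq_zero_left (relation_ab lam)
  have h₂ : a lam * a lam = aSq lam • e lam .M := by
    rw [aSq_smul_M (e_mul_e_self lam .M), mul_assoc, a_mul_e]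
  have h₃ : a lam * (b lam * a lam) = -(aSq lam • b lam) := by
    rw [aSq_smul_M (e_mul_b lam)]
    linear_combination (norm := noncomm_ring) a lam * relation_ab lam
  simp only [realizeColumn_apply, mul_add, mul_smul_comm, Matrix.cons_val, a_mul_e, h₁, h₂, h₃]
  module

theorem b_mul_realizeM (v : ModelM) : b lam * realizeM lam v = realizeM lam (modelB v) := by
  simp only [realizeM_apply, mul_add, ← mul_assoc (b lam), b_mul_realizeColumn]
  rfl

theorem a_mul_realizeM (v : ModelM) :
    a lam * realizeM lam v = realizeM lam (modelA lam v) := by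
  simp only [realizeM_apply, mul_add, ← mul_assoc (a lam), a_mul_realizeColumn]
  rfl

theorem e_mul_realizeM (v : ModelM) : e lam .M * realizeM lam v = realizeM lam v := by
  have h (q) : e lam .M * realizeColumn lam q = realizeColumn lam q := by
    simp only [realizeColumn_apply, mul_add, mul_smul_comm, ← mul_assoc (e lam _),
      e_mul_e_self, e_mul_a, e_mul_b]
  simp only [realizeM_apply, mul_add, ← mul_assoc (e lam _), h]

theorem e_mul_realizeR (r : ModelR) : e lam .R * realizeR lam r = realizeR lam r := by
  simp only [realizeR_apply, mul_add, mul_smul_comm, ← mul_assoc (e lam _), e_mul_e_self, e_mul_c]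

theorem d_mul_realizeR (r : ModelR) : d lam * realizeR lam r = realizeM lam (modelD r) := by
  have hz := z_smul_M (e_mul_a lam)
  have hz' := z_smul_M (e_mul_b lam)
  have hw := w_smul_M (e_mul_a lam)
  have hy := y_smul_M (e_mul_b lam)
  -- The definitions of the M components of y and w are solved for dca here and for dcb in `h₂`.
  have h₁ : d lam * (c lam * a lam)
      = (X 2 : Coeff) • e lam .M - (X 0 : Coeff) • a lam - a lam * (d lam * c lam) := by
    rw [hz, y_smul_M (e_mul_e_self lam .M)]
    simp only [yM, add_mul, mul_assoc, c_mul_e, a_mul_e]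
    abel
  have h₂ : d lam * (c lam * b lam)
      = (X 1 : Coeff) • e lam .M - (X 0 : Coeff) • b lam - b lam * (d lam * c lam) := by
    rw [hz', w_smul_M (e_mul_e_self lam .M)]
    simp only [wM, add_mul, mul_assoc, c_mul_e, b_mul_e]
    abel
  have h₃ : d lam * (c lam * (b lam * a lam))
      = (X 1 : Coeff) • a lam - (X 2 : Coeff) • b lam + b lam * (a lam * (d lam * c lam)) := by
    rw [hw, hy]
    have h := dcba_eq (algebraMap_comm lam _) (relation_ab lam) (relation_a_sq lam)
    simpa only [wM, yM, mul_assoc] using h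
  have hdc : d lam * (c lam * d lam) = -((X 0 : Coeff) • d lam) := by
    rw [z_smul_M (e_mul_d lam)]
    linear_combination (norm := noncomm_ring) relation_d lam
  -- Right multiplication of `h₃` by d, with dcd = −z d.
  have h₅ : d lam * (c lam * (b lam * (a lam * d lam))) = (X 1 : Coeff) • (a lam * d lam)
      - (X 2 : Coeff) • (b lam * d lam) - (X 0 : Coeff) • (b lam * (a lam * d lam)) := by
    have h := congrArg (· * d lam) h₃
    simp only [add_mul, sub_mul, smul_mul_assoc, mul_assoc, hdc, mul_neg, mul_smul_comm] at h
    rw [h, sub_eq_add_neg _ ((X 0 : Coeff) • (b lam * (a lam * d lam)))]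
  rw [realizeR_apply, realizeM_apply]
  simp only [realizeColumn_apply, mul_add, mul_smul_comm, h₁, h₂, h₃, h₅, d_mul_e, modelD,
    LinearMap.coe_mk, AddHom.coe_mk, Matrix.cons_val, add_mul, smul_mul_assoc, mul_assoc]
  simp only [← mul_assoc (e lam _), e_mul_d]
  module

theorem c_mul_realizeM (v : ModelM) : c lam * realizeM lam v = realizeR lam (modelC v) := by
  have hR {x : Alg lam} : e lam .R * (c lam * x) = c lam * x := by rw [← mul_assoc, e_mul_c]
  have hz : c lam * d lam = -((X 0 : Coeff) • e lam .R) := by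
    rw [z_smul_R (e_mul_e_self lam .R), neg_neg, mul_assoc, d_mul_e]
  have hw : c lam * (b lam * d lam) = (X 1 : Coeff) • e lam .R := by
    rw [w_smul_R (e_mul_e_self lam .R), mul_assoc, mul_assoc, d_mul_e]
  have hy : c lam * (a lam * d lam) = (X 2 : Coeff) • e lam .R := by
    rw [y_smul_R (e_mul_e_self lam .R), mul_assoc, mul_assoc, d_mul_e]
  have hz' : c lam * (d lam * c lam) = -((X 0 : Coeff) • c lam) := by
    rw [← mul_assoc, hz, neg_mul, smul_mul_assoc, e_mul_c]
  have hw' : c lam * (b lam * (d lam * c lam)) = (X 1 : Coeff) • c lam := by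
    rw [← mul_assoc (b lam), ← mul_assoc, hw, smul_mul_assoc, e_mul_c]
  have hy' : c lam * (a lam * (d lam * c lam)) = (X 2 : Coeff) • c lam := by
    rw [← mul_assoc (a lam), ← mul_assoc, hy, smul_mul_assoc, e_mul_c]
  have h : c lam * (b lam * (a lam * (d lam * c lam))) = -((X 0 : Coeff) • (c lam * (b lam * a lam)))
      - (X 1 : Coeff) • (c lam * a lam) + (X 2 : Coeff) • (c lam * b lam) := by
    rw [z_smul_R hR, w_smul_R hR, y_smul_R hR]
    linear_combination (norm := noncomm_ring)
      cbadc_eq (algebraMap_comm lam _) (relation_c lam) (relation_ab lam) (relation_a_sq lam)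
  rw [realizeR_apply, realizeM_apply]
  simp only [realizeColumn_apply, mul_add, mul_smul_comm, modelC, c_mul_e,
    LinearMap.coe_mk, AddHom.coe_mk, Matrix.cons_val, add_mul, smul_mul_assoc, mul_assoc]
  simp only [← mul_assoc (e lam _), e_mul_d, hz, hw, hy, hz', hw', hy', h]
  module

/-- The element of the algebra with given coordinates. -/
def realize : Model →ₗ[ℂ] Alg lam := (realizeM lam).coprod (realizeR lam)

theorem realize_apply (v : Model) : realize lam v = realizeM lam v.1 + realizeR lam v.2 := rfl

/-- The realization is a homomorphism of left modules. -/
theorem realize_action (x : Alg lam) (v : Model) :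
    realize lam (action lam x v) = x * realize lam v := by
  have hR {y : Alg lam} (hy : y * e lam .M = y) (r : ModelR) : y * realizeR lam r = 0 :=
    mul_eq_zero_of_ne hy (e_mul_realizeR lam r) (by decide)
  have hM {y : Alg lam} (hy : y * e lam .R = y) (u : ModelM) : y * realizeM lam u = 0 :=
    mul_eq_zero_of_ne hy (e_mul_realizeM lam u) (by decide)
  -- The elements compatible with `realize` form a subalgebra, which leaves the generators.
  let B : Subalgebra ℂ (Alg lam) :=
    { carrier := {x | ∀ v, realize lam (action lam x v) = x * realize lam v}
      mul_mem' := fun {x y} hx hy v => by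
        rw [map_mul, Module.End.mul_apply, hx, hy, mul_assoc]
      add_mem' := fun {x y} hx hy v => by
        rw [map_add, LinearMap.add_apply, map_add, hx, hy, add_mul]
      algebraMap_mem' := fun r v => by
        rw [AlgHom.commutes, Module.algebraMap_end_apply, map_smul, Algebra.smul_def] }
  have hB : B = ⊤ := by
    refine subalgebra_eq_top B ?_ ?_ ?_ ?_ ?_
    · rintro (_ | _) v <;> rw [action_e, realize_apply lam v, mul_add]
      · rw [hM (e_mul_e_self lam .R), e_mul_realizeR, zero_add]
        simp [modelIdem, realize_apply]
      · rw [hR (e_mul_e_self lam .M), e_mul_realizeM, add_zero]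
        simp [modelIdem, realize_apply]
    · intro v
      rw [action_a, realize_apply, realize_apply, mul_add, a_mul_realizeM, hR (a_mul_e lam),
        map_zero]
    · intro v
      rw [action_b, realize_apply, realize_apply, mul_add, b_mul_realizeM, hR (b_mul_e lam),
        map_zero]
    · intro v
      rw [action_c, realize_apply, realize_apply, mul_add, c_mul_realizeM, hR (c_mul_e lam),
        map_zero, add_zero, zero_add]
    · intro v
      rw [action_d, realize_apply, realize_apply, mul_add, d_mul_realizeR, hM (d_mul_e lam),
        map_zero, add_zero, zero_add]
  have hx : x ∈ B := hB ▸ Algebra.mem_top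
  exact hx v

/-- The coordinates of the unit. -/
def modelOne : Model := (![![1, 0, 0, 0], 0, 0], ![0, 0, 0, 0, 1, 0])

theorem realize_modelOne : realize lam modelOne = 1 := by
  rw [one_eq_add, realize_apply, realizeM_apply, realizeR_apply]
  simp [modelOne, realizeColumn_apply]

/-- The coordinates of an element of the algebra. -/
def coords : Alg lam →ₗ[ℂ] Model :=
  LinearMap.applyₗ modelOne ∘ₗ (action lam).toLinearMap

/-- By linearity, x · `modelOne` is realized as x · 1. This one-sided inverse is all that is needed;
freeness of the spanning sets never enters. -/
theorem realize_coords (x : Alg lam) : realize lam (coords lam x) = x := by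
  refine (realize_action lam x modelOne).trans ?_
  rw [realize_modelOne, mul_one]

theorem coords_injective : Function.Injective (coords lam) :=
  Function.LeftInverse.injective (realize_coords lam)

theorem coords_mul (x y : Alg lam) : coords lam (x * y) = action lam x (coords lam y) := by
  change action lam (x * y) modelOne = _
  rw [map_mul]
  rfl

end Realize

/-! ## Regularity in the algebra -/

section Regularity

variable {lam : ℂ} {x : Alg lam}

theorem coords_snd_of_M (hx : e lam .M * x = x) : (coords lam x).2 = 0 := by
  rw [← hx, coords_mul, action_e]
  rfl

theorem coords_fst_of_R (hx : e lam .R * x = x) : (coords lam x).1 = 0 := by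
  rw [← hx, coords_mul, action_e]
  rfl

/-- Left multiplication by `b` is injective on `e_M A`. -/
theorem eq_zero_of_b_mul (hx : e lam .M * x = x) (h : b lam * x = 0) : x = 0 := by
  refine coords_injective lam ?_
  have h' := congrArg (coords lam) h
  rw [coords_mul, action_b, map_zero] at h'
  rw [map_zero]
  exact Prod.ext (modelB_injective ((congrArg Prod.fst h').trans (map_zero _).symm))
    (coords_snd_of_M hx)

/-- Left multiplication by `d` is injective on `e_R A`. -/
theorem eq_zero_of_d_mul (hx : e lam .R * x = x) (h : d lam * x = 0) : x = 0 := by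
  refine coords_injective lam ?_
  have h' := congrArg (coords lam) h
  rw [coords_mul, action_d, map_zero] at h'
  rw [map_zero]
  exact Prod.ext (coords_fst_of_R hx)
    (modelD_injective ((congrArg Prod.fst h').trans (map_zero _).symm))

/-- Left multiplication by `a` is injective on `e_M A / b A`. -/
theorem exists_b_mul_of_a_mul {u : Alg lam} (hx : e lam .M * x = x)
    (h : a lam * x = b lam * u) : ∃ v, x = b lam * v := by
  have h' := congrArg (coords lam) h
  rw [coords_mul, coords_mul, action_a, action_b] at h'
  obtain ⟨v, hv⟩ := exists_modelB_of_modelA (congrArg Prod.fst h')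
  refine ⟨realizeM lam v, ?_⟩
  rw [← realize_coords lam x, realize_apply, coords_snd_of_M hx, map_zero, add_zero, hv,
    b_mul_realizeM]

/-- The elements of `e_R A` that left multiplication by `d` maps into `a A + b A`. -/
theorem exists_of_d_mul {u v : Alg lam} (hx : e lam .R * x = x)
    (h : d lam * x = a lam * u + b lam * v) :
    ∃ p q, x = c lam * d lam * p + c lam * b lam * q := by
  have h' := congrArg (coords lam) h
  rw [map_add, coords_mul, coords_mul, coords_mul, action_a, action_b, action_d] at h'
  obtain ⟨p, q, hpq⟩ := exists_modelC_of_modelD (congrArg Prod.fst h')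
  refine ⟨realizeR lam p, realizeM lam q, ?_⟩
  rw [← realize_coords lam x, realize_apply, coords_fst_of_R hx, map_zero, zero_add, hpq, map_add,
    ← c_mul_realizeM, ← c_mul_realizeM, ← d_mul_realizeR, ← b_mul_realizeM, mul_assoc, mul_assoc]

end Regularity

end MorrisonPinkham

end

/-! ### Projectivity and exactness of the sequence -/

namespace MorrisonPinkham

section Resolution

variable {lam : ℂ}

theorem mem_P_iff {v : Vertex} {x : Alg lam} : x ∈ P lam v ↔ e lam v * x = x := by
  constructor
  · rintro ⟨y, rfl⟩
    change e lam v * (e lam v * y) = e lam v * y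
    rw [← mul_assoc, e_mul_e_self]
  · exact fun h => ⟨x, h⟩

theorem e_mul_coe {v : Vertex} (x : P lam v) : e lam v * (x : Alg lam) = x := mem_P_iff.1 x.2

theorem e_mul_mem_P (v : Vertex) (x : Alg lam) : e lam v * x ∈ P lam v := ⟨x, rfl⟩

theorem coe_mulMap {i j : Vertex} (x : Alg lam) (hx : e lam j * x = x) (y : P lam i) :
    (mulMap lam i j x hx y : Alg lam) = x * y := rfl

-- Left multiplication by the idempotent e_v splits the inclusion of e_v A into the regular module.
variable (lam) in
theorem projective_P (v : Vertex) : Module.Projective (Alg lam)ᵐᵒᵖ (P lam v) := by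
  let i : P lam v →ₗ[(Alg lam)ᵐᵒᵖ] (Alg lam)ᵐᵒᵖ :=
    { toFun := fun y => MulOpposite.op (y : Alg lam)
      map_add' := fun _ _ => rfl
      map_smul' := fun _ _ => rfl }
  let s : (Alg lam)ᵐᵒᵖ →ₗ[(Alg lam)ᵐᵒᵖ] P lam v :=
    { toFun := fun y => ⟨e lam v * y.unop, e_mul_mem_P v _⟩
      map_add' := fun y z => Subtype.ext (mul_add _ _ _)
      map_smul' := fun r y => Subtype.ext (mul_assoc _ _ _).symm }
  refine Module.Projective.of_split i s (LinearMap.ext fun y => Subtype.ext ?_)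
  exact e_mul_coe y

theorem b_mul_cancel {u v : Alg lam} (hu : e lam .M * u = u) (hv : e lam .M * v = v)
    (h : b lam * u = b lam * v) : u = v := by
  refine sub_eq_zero.1 (eq_zero_of_b_mul ?_ ?_)
  · rw [mul_sub, hu, hv]
  · rw [mul_sub, h, sub_self]

variable (lam) in
theorem mulMap_b_injective : Function.Injective (mulMap lam .M .M (b lam) (e_mul_b lam)) :=
  fun u v h => Subtype.ext (b_mul_cancel (e_mul_coe u) (e_mul_coe v) (congrArg Subtype.val h))

variable (lam) in
theorem f₂_injective : Function.Injective (f₂ lam) := fun _ _ h =>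
  mulMap_b_injective lam (congrArg (fun p => p.2.2) h)

theorem f₁_eq_zero_iff (x : P lam .R) (u v : P lam .M) : f₁ lam (x, u, v) = 0 ↔
    c lam * d lam * x + c lam * b lam * v = 0 ∧ b lam * (u : Alg lam) + a lam * v = 0 ∧
      b lam * d lam * x + (a lam * u + (d lam * c lam + lam • b lam + b lam ^ 2) * v) = 0 := by
  rw [Prod.ext_iff, Prod.ext_iff, Subtype.ext_iff, Subtype.ext_iff, Subtype.ext_iff]
  simp [f₁, coe_mulMap]

theorem f₀_eq_zero_iff (x : P lam .R) (u v : P lam .M) : f₀ lam (x, u, v) = 0 ↔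
    d lam * (x : Alg lam) + (a lam * u + b lam * v) = 0 := by
  rw [Subtype.ext_iff]
  simp [f₀, coe_mulMap]

variable (lam) in
theorem smul_b (x : Alg lam) :
    lam • b lam * x = algebraMap ℂ _ lam * (b lam * x) := by
  rw [Algebra.smul_def, mul_assoc]

variable (lam) in
theorem exact_f₂_f₁ : Function.Exact (f₂ lam) (f₁ lam) := by
  rintro ⟨x, u, v⟩
  rw [f₁_eq_zero_iff]
  constructor
  · rintro ⟨-, h₂, h₃⟩
    have hav : a lam * (v : Alg lam) = b lam * -(u : Alg lam) := by
      rw [mul_neg]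
      exact eq_neg_of_add_eq_zero_right h₂
    obtain ⟨p', hp'⟩ := exists_b_mul_of_a_mul (e_mul_coe v) hav
    -- Since b e_M = b, the factor can be replaced by its projection to e_M A.
    obtain ⟨p, hp, hpM⟩ : ∃ p, (v : Alg lam) = b lam * p ∧ e lam .M * p = p :=
      ⟨e lam .M * p', by rw [← mul_assoc, b_mul_e, hp'], by rw [← mul_assoc, e_mul_e_self]⟩
    have hu : (u : Alg lam) = a lam * p := by
      refine b_mul_cancel (e_mul_coe u) (by rw [← mul_assoc, e_mul_a]) ?_
      rw [hp] at h₂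
      linear_combination (norm := noncomm_ring) h₂ - relation_ab lam * p
    -- With u = ap and v = bp, the relation for a² turns the third row into b(dx − dcp) = 0.
    have hdx : d lam * (x : Alg lam) = d lam * (c lam * p) := by
      refine b_mul_cancel (by rw [← mul_assoc, e_mul_d]) (by rw [← mul_assoc, e_mul_d]) ?_
      rw [hu, hp, add_mul, add_mul, smul_b] at h₃
      linear_combination (norm := noncomm_ring) h₃ - relation_a_sq lam * p
    have hx : (x : Alg lam) = c lam * p := by
      refine sub_eq_zero.1 (eq_zero_of_d_mul ?_ ?_)
      · rw [mul_sub, e_mul_coe, ← mul_assoc, e_mul_c]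
      · rw [mul_sub, hdx, sub_self]
    exact ⟨⟨p, mem_P_iff.2 hpM⟩, Prod.ext (Subtype.ext hx.symm)
      (Prod.ext (Subtype.ext hu.symm) (Subtype.ext hp.symm))⟩
  · rintro ⟨p, hp⟩
    obtain rfl : mulMap lam .M .R (c lam) (e_mul_c lam) p = x := congrArg Prod.fst hp
    obtain rfl : mulMap lam .M .M (a lam) (e_mul_a lam) p = u := congrArg (fun q => q.2.1) hp
    obtain rfl : mulMap lam .M .M (b lam) (e_mul_b lam) p = v := congrArg (fun q => q.2.2) hp
    simp only [coe_mulMap, add_mul (_ + _) (b lam ^ 2), add_mul _ (lam • b lam), smul_b]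
    refine ⟨?_, ?_, ?_⟩
    · linear_combination (norm := noncomm_ring) relation_c lam * p
    · linear_combination (norm := noncomm_ring) relation_ab lam * p
    · linear_combination (norm := noncomm_ring) relation_a_sq lam * p

theorem f₀_f₁_apply (q : P lam .R × P lam .M × P lam .M) : f₀ lam (f₁ lam q) = 0 := by
  obtain ⟨x, u, v⟩ := q
  refine (f₀_eq_zero_iff _ _ _).2 ?_
  simp only [LinearMap.coprod_apply, LinearMap.zero_apply,
    Submodule.coe_add, Submodule.coe_zero, coe_mulMap]
  rw [add_mul (_ + _) (b lam ^ 2), add_mul _ (lam • b lam), smul_b]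
  -- Each column of the product of the matrices is one relation; the last summand moves λ past b.
  linear_combination (norm := noncomm_ring) relation_d lam * x + relation_ab lam * u
    + relation_a_sq lam * v + algebraMap_comm lam (b lam) * (b lam * v)

variable (lam) in
theorem exact_f₁_f₀ : Function.Exact (f₁ lam) (f₀ lam) := by
  intro q
  refine ⟨fun h => ?_, ?_⟩
  swap
  · rintro ⟨q, rfl⟩
    exact f₀_f₁_apply q
  -- Successive corrections by the columns of `f₁` reduce to `q = 0`.
  suffices h₁ : ∃ s, ((q - f₁ lam s).1 = 0) by
    obtain ⟨s, hs⟩ := h₁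
    suffices h₂ : ∃ t, q - f₁ lam s = f₁ lam t by
      obtain ⟨t, ht⟩ := h₂
      exact ⟨t + s, by rw [map_add, ← ht, sub_add_cancel]⟩
    have h' : f₀ lam (q - f₁ lam s) = 0 := by rw [map_sub, h, f₀_f₁_apply, sub_self]
    generalize q - f₁ lam s = q' at hs h'
    obtain ⟨x, u, v⟩ := q'
    obtain rfl : x = 0 := hs
    rw [f₀_eq_zero_iff, Submodule.coe_zero, mul_zero, zero_add] at h'
    -- With first entry 0, au + bv = 0 forces u = bp and v = ap, a multiple of the second column of
    -- `f₁`.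
    obtain ⟨p, hp⟩ := exists_b_mul_of_a_mul (u := -(v : Alg lam)) (e_mul_coe u)
      (by rw [mul_neg]; exact eq_neg_of_add_eq_zero_left h')
    have hu : (u : Alg lam) = b lam * (e lam .M * p) := by rw [← mul_assoc, b_mul_e, hp]
    have hv : (v : Alg lam) = a lam * (e lam .M * p) := by
      refine b_mul_cancel (e_mul_coe v) (by rw [← mul_assoc, e_mul_a]) ?_
      rw [hu] at h'
      linear_combination (norm := noncomm_ring) h' - relation_ab lam * (e lam .M * p)
    refine ⟨(0, ⟨e lam .M * p, e_mul_mem_P .M p⟩, 0), Prod.ext ?_ (Prod.ext ?_ ?_)⟩ <;>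
      refine Subtype.ext ?_ <;> simp [f₁, coe_mulMap, hu, hv]
  obtain ⟨x, u, v⟩ := q
  rw [f₀_eq_zero_iff] at h
  -- The first row of `f₁` is (cd, 0, cb), so x can be removed once it lies in cdA + cbA.
  obtain ⟨p, q, hpq⟩ := exists_of_d_mul (u := -(u : Alg lam)) (v := -(v : Alg lam)) (e_mul_coe x)
    (by linear_combination (norm := noncomm_ring) h)
  refine ⟨(⟨e lam .R * p, e_mul_mem_P .R p⟩, 0, ⟨e lam .M * q, e_mul_mem_P .M q⟩), ?_⟩
  refine Subtype.ext ?_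
  simp [f₁, coe_mulMap, hpq, mul_assoc, ← mul_assoc (d lam) (e lam .R),
    ← mul_assoc (b lam) (e lam .M), d_mul_e, b_mul_e]

theorem character_idem_self (v : Vertex) : character lam v (e lam v) = 1 :=
  (RingQuot.liftAlgHom_mkAlgHom_apply _ _ _ _).trans (PathAlgebra.coeffIdem_idem v)

theorem character_idem_of_ne {v w : Vertex} (h : w ≠ v) : character lam v (e lam w) = 0 := by
  refine (RingQuot.liftAlgHom_mkAlgHom_apply _ _ _ _).trans
    (PathAlgebra.coeffIdem_ofPath_of_ne fun h' => h ?_)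
  exact congrArg QuiverPath.src h'

theorem character_arrow (v : Vertex) {i j : Vertex} (f : Arrow i j) :
    character lam v (RingQuot.mkAlgHom ℂ (Rel lam) (arrow f)) = 0 :=
  (RingQuot.liftAlgHom_mkAlgHom_apply _ _ _ _).trans
    (PathAlgebra.coeffIdem_ofArrow (V := Vertex) v f)

/-- Every element of `e_M A` is a multiple of `e_M` up to the right ideal generated by the arrows
that end at `M`. -/
theorem exists_eM_mul_eq (x : Alg lam) : ∃ r u v, e lam .M * x
    = character lam .M x • e lam .M + (d lam * r + (a lam * u + b lam * v)) := by
  let B : Subalgebra ℂ (Alg lam) :=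
    { carrier := {x | ∃ r u v, e lam .M * x
        = character lam .M x • e lam .M + (d lam * r + (a lam * u + b lam * v))}
      mul_mem' := by
        rintro x y ⟨r, u, v, hx⟩ ⟨r', u', v', hy⟩
        -- Multiplying the expansion of e_M x by y leaves χ(x) e_M y, where χ is the character at M;
        -- this is expanded in turn.
        refine ⟨character lam .M x • r' + r * y, character lam .M x • u' + u * y,
          character lam .M x • v' + v * y, ?_⟩
        rw [← mul_assoc, hx, add_mul, smul_mul_assoc, hy, map_mul, mul_smul]
        simp only [smul_add, mul_add, add_mul, mul_smul_comm, mul_assoc]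
        abel
      add_mem' := by
        rintro x y ⟨r, u, v, hx⟩ ⟨r', u', v', hy⟩
        refine ⟨r + r', u + u', v + v', ?_⟩
        rw [mul_add, hx, hy, map_add, add_smul]
        simp only [mul_add]
        abel
      algebraMap_mem' := fun r => ⟨0, 0, 0, by
        rw [AlgHom.commutes, ← Algebra.commutes, ← Algebra.smul_def]
        simp⟩ }
  have hB : B = ⊤ := by
    refine subalgebra_eq_top B ?_ ⟨0, 1, 0, ?_⟩ ⟨0, 0, 1, ?_⟩ ⟨0, 0, 0, ?_⟩ ⟨1, 0, 0, ?_⟩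
    · rintro (_ | _) <;> refine ⟨0, 0, 0, ?_⟩
      · rw [character_idem_of_ne (by decide), e_mul_e_of_ne lam (by decide)]
        simp
      · rw [character_idem_self, e_mul_e_self]
        simp
    · rw [e_mul_a, a, character_arrow]
      simp
    · rw [e_mul_b, b, character_arrow]
      simp
    · rw [mul_eq_zero_of_ne (e_mul_e_self lam .M) (e_mul_c lam) (by decide), c, character_arrow]
      simp
    · rw [e_mul_d, d, character_arrow]
      simp
  have hx : x ∈ B := hB ▸ Algebra.mem_top
  exact hx

variable (lam) in
theorem exact_f₀_augmentation : Function.Exact (f₀ lam) (augmentation lam .M) := by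
  intro y
  constructor
  · intro hy
    have hy' : character lam .M (y : Alg lam) = 0 := hy
    obtain ⟨r, u, v, h⟩ := exists_eM_mul_eq (y : Alg lam)
    rw [hy', zero_smul, zero_add, e_mul_coe] at h
    refine ⟨(⟨e lam .R * r, e_mul_mem_P .R r⟩, ⟨e lam .M * u, e_mul_mem_P .M u⟩,
      ⟨e lam .M * v, e_mul_mem_P .M v⟩), Subtype.ext ?_⟩
    rw [h]
    simp [f₀, coe_mulMap, ← mul_assoc, d_mul_e, a_mul_e, b_mul_e]
  · rintro ⟨⟨x, u, v⟩, rfl⟩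
    change character lam .M (d lam * (x : Alg lam) + (a lam * u + b lam * v)) = 0
    have ha : character lam .M (a lam) = 0 := character_arrow .M .a
    have hb : character lam .M (b lam) = 0 := character_arrow .M .b
    have hd : character lam .M (d lam) = 0 := character_arrow .M .d
    simp [ha, hb, hd]

variable (lam) in
theorem augmentation_surjective (v : Vertex) : Function.Surjective (augmentation lam v) := by
  intro r
  have hr : (show ℂ from r) • e lam v ∈ P lam v := by
    rw [mem_P_iff, mul_smul_comm, e_mul_e_self]
  refine ⟨⟨_, hr⟩, ?_⟩
  change character lam v ((show ℂ from r) • e lam v) = r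
  rw [map_smul, character_idem_self]
  exact mul_one (show ℂ from r)

end Resolution

end MorrisonPinkham

open MorrisonPinkham in
theorem theorem4 (lam : ℂ) :
    (Module.Projective (Alg lam)ᵐᵒᵖ (P lam .R) ∧ Module.Projective (Alg lam)ᵐᵒᵖ (P lam .M)) ∧
    Function.Injective (f₂ lam) ∧
    Function.Exact (f₂ lam) (f₁ lam) ∧
    Function.Exact (f₁ lam) (f₀ lam) ∧
    Function.Exact (f₀ lam) (augmentation lam .M) ∧
    Function.Surjective (augmentation lam .M) ∧
    Function.Injective (mulMap lam .M .M (b lam) (e_mul_b lam)) :=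
  ⟨⟨projective_P lam .R, projective_P lam .M⟩, f₂_injective lam, exact_f₂_f₁ lam, exact_f₁_f₀ lam,
    exact_f₀_augmentation lam, augmentation_surjective lam .M, mulMap_b_injective lam⟩
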